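/- Let $G$ be a (Hausdorff) locally compact group with a fixed left Haar measure $m$. Let $\mathcal M_{00}(G)_+$ be the set of positive finite regular Borel measures on $G$ with compact support, $\mathcal M^1_{00}(G)=\{\mu\in\mathcal M_{00}(G)_+:\mu(G)=1\}$, and let $\mathcal C^1_{00}(G)$ be the set of continuous compactly supported $\phi\ge 0$ on $G$ with $\int\phi\,dm=1$. Let $L^\infty(G)$ be the space of real-valued bounded Borel functions on $G$ modulo locally null sets (if $G$ is $\sigma$-compact, these are just the null sets), ordered locally almost everywhere, and let $\mathcal C^b_{ru}(G)$ be the space of bounded functions $h:G\to\mathbb R$ such that for each $\varepsilon>0$ there is a neighbourhood $U$ of the identity with $|h(ux)-h(x)|<\varepsilon$ for all $u\in U$, $x\in G$. Write $(\mu*h)(g)=\int h(x^{-1}g)\,d\mu(x)$ and $(\phi*h)(g)=\int\phi(x)h(x^{-1}g)\,dm(x)$. For $E\in\{L^\infty(G),\mathcal C^b_{ru}(G)\}$ and $0\ne f\in E$ with $f\ge 0$ put $$(E,f)_{\mathcal M}=\{h\in E:\ |h|\le\lambda*f\text{ for some }\lambda\in\mathcal M_{00}(G)_+\}.$$ A measurably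 invariant normalized integral on $(E,f)_{\mathcal M}$ is a positive linear functional $I:(E,f)_{\mathcal M}\to\mathbb R$ with $I(f)=1$ and $I(\mu*v)=I(v)$ for all $\mu\in\mathcal M^1_{00}(G)$ and $v\in(E,f)_{\mathcal M}$. The group $G$ has the measurably invariant normalized integral property for $E$ if such an $I$ exists for every non-zero $f\in E$ with $f\ge 0$. **Proposition.** If $G$ has the measurably invariant normalized integral property for $\mathcal C^b_{ru}(G)$, then $G$ has it for $L^\infty(G)$. More precisely, let $f\in L^\infty(G)$ be non-zero with $f\ge 0$. Then $(L^\infty(G),f)_{\mathcal M}$ is stable under convolution by $\mathcal M^1_{00}(G)$; and for every $\phi\in\mathcal C^1_{00}(G)$, the function $\phi*f$ is a non-zero positive element of $\mathcal C^b_{ru}(G)$, $T:h\mapsto\phi*h$ is a well-defined linear map $(L^\infty(G),f)_{\mathcal M}\to(\mathcal C^b_{ru}(G),\phi*f)_{\mathcal M}$, and for every measurably invariant normalized integral $I$ on $(\mathcal C^b_{ru}(G),\phi*f)_{\mathcal M}$ the functional $I\circ T$ is a measurably invariant normalized integral on $(L^\infty(G),f)_{\mathcal M}$. -/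

import Mathlib

open MeasureTheory Topology

set_option linter.unusedSectionVars false

namespace MeasInv

variable {G : Type*} [Group G] [TopologicalSpace G] [MeasurableSpace G]

/-- `μ` is a positive finite regular Borel measure on `G` with compact support, that is, an element
of `M₀₀(G)₊`. (For a regular measure, being concentrated on a compact set is the same as having
compact support.) -/
structure IsM00 (μ : Measure G) : Prop where
  finite : IsFiniteMeasure μ
  regular : μ.Regular
  compact : ∃ K : Set G, IsCompact K ∧ μ Kᶜ = 0

/-- `μ ∈ M₀₀¹(G)`: a probability measure in `M₀₀(G)₊`. -/
def IsM001 (μ : Measure G) : Prop := IsM00 μ ∧ μ Set.univ = 1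

/-- `φ ∈ C₀₀¹(G)`: a continuous, compactly supported, nonnegative function of integral one. -/
def IsC001 (m : Measure G) (φ : G → ℝ) : Prop :=
  Continuous φ ∧ HasCompactSupport φ ∧ (∀ x, 0 ≤ φ x) ∧ ∫ x, φ x ∂m = 1

/-- The convolution `(μ * F)(g) = ∫ F(x⁻¹ g) dμ(x)`. -/
noncomputable def conv (μ : Measure G) (F : G → ℝ) : G → ℝ := fun g => ∫ x, F (x⁻¹ * g) ∂μ

theorem IsM00.add {μ ν : Measure G} [T2Space G] [BorelSpace G] (hμ : IsM00 μ) (hν : IsM00 ν) :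
    IsM00 (μ + ν) := by
  obtain ⟨h1, h2, K, hK, hK0⟩ := hμ
  obtain ⟨h1', h2', L, hL, hL0⟩ := hν
  refine ⟨inferInstance, ?_, K ∪ L, hK.union hL, ?_⟩
  · infer_instance
  · rw [Measure.add_apply, Set.compl_union]
    simp [measure_mono_null Set.inter_subset_left hK0,
      measure_mono_null Set.inter_subset_right hL0]

theorem IsM00.smul {μ : Measure G} (hμ : IsM00 μ) (c : NNReal) : IsM00 (c • μ) := by
  obtain ⟨h1, h2, K, hK, hK0⟩ := hμ
  exact ⟨inferInstance, Measure.Regular.smul_nnreal c, K, hK, by simp [hK0]⟩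

theorem isM00_dirac [T2Space G] [BorelSpace G] [LocallyCompactSpace G] (g : G) :
    IsM00 (Measure.dirac g) := by
  refine ⟨inferInstance, ?_, {g}, isCompact_singleton, by simp⟩
  have : (Measure.dirac g).InnerRegular := by
    refine ⟨fun A hA r hr => ?_⟩
    by_cases hg : g ∈ A
    · exact ⟨{g}, by simpa using hg, isCompact_singleton, by simpa [hg] using hr⟩
    · simp [hg] at hr
  infer_instance

/-- A space `E` of functions (or classes of functions) on `G`, inside an ordered space `V`,
together with the convolution action `(μ, f) ↦ μ * f` of the measures in `M₀₀(G)₊`. The spaces in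
question are `cru G` and `linf m` below. -/
structure FunSpace (G : Type*) [Group G] [TopologicalSpace G] [MeasurableSpace G]
    (V : Type*) [AddCommGroup V] [Module ℝ V] [Lattice V] where
  E : Submodule ℝ V
  act : Measure G → E → V
  act_add : ∀ μ ν, IsM00 μ → IsM00 ν → ∀ f, act (μ + ν) f = act μ f + act ν f
  act_smul : ∀ (c : NNReal) μ, IsM00 μ → ∀ f, act (c • μ) f = (c : ℝ) • act μ f
  act_one : ∀ f, act (Measure.dirac 1) f = f

section generic

variable [T2Space G] [BorelSpace G] [LocallyCompactSpace G]
variable {V : Type*} [AddCommGroup V] [Module ℝ V] [Lattice V] [IsOrderedAddMonoid V]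
  [PosSMulMono ℝ V]

/-- `(E, f)_M`: the `h ∈ E` with `|h| ≤ μ * f` for some `μ ∈ M₀₀(G)₊`. -/
def FunSpace.dom (S : FunSpace G V) (f : S.E) : Submodule ℝ S.E where
  carrier := {h | ∃ μ : Measure G, IsM00 μ ∧ |(h : V)| ≤ S.act μ f}
  add_mem' := by
    rintro a b ⟨μ, hμ, ha⟩ ⟨ν, hν, hb⟩
    refine ⟨μ + ν, hμ.add hν, ?_⟩
    rw [S.act_add μ ν hμ hν]
    exact (abs_add_le _ _).trans (add_le_add ha hb)
  zero_mem' := by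
    refine ⟨(0 : NNReal) • Measure.dirac 1, (isM00_dirac 1).smul 0, ?_⟩
    rw [S.act_smul 0 _ (isM00_dirac 1)]
    simp
  smul_mem' := by
    rintro c a ⟨μ, hμ, ha⟩
    refine ⟨‖c‖₊ • μ, hμ.smul _, ?_⟩
    rw [S.act_smul _ _ hμ]
    have h : |c • (a : V)| ≤ |c| • |(a : V)| := by
      rw [abs_le']
      have hc : ∀ (t : ℝ) (v : V), t • v ≤ |t| • |v| := by
        intro t v
        rcases le_total 0 t with ht | ht
        · rw [abs_of_nonneg ht]
          exact smul_le_smul_of_nonneg_left (le_abs_self v) ht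
        · rw [abs_of_nonpos ht, ← neg_smul_neg t v]
          exact smul_le_smul_of_nonneg_left (neg_le_abs v) (neg_nonneg.2 ht)
      refine ⟨hc c a, ?_⟩
      rw [← neg_smul, ← abs_neg c]
      exact hc (-c) a
    exact h.trans (smul_le_smul_of_nonneg_left ha (abs_nonneg c))

theorem FunSpace.mem_dom_self (S : FunSpace G V) (f : S.E) (hf : 0 ≤ (f : V)) : f ∈ S.dom f :=
  ⟨Measure.dirac 1, isM00_dirac 1, by rw [S.act_one, abs_of_nonneg hf]⟩

/-- `I` is a measurably invariant normalized integral on `(E, f)_M`: a positive linear functional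
with `I(μ * v) = I(v)` for `μ ∈ M₀₀¹(G)` and `v ∈ (E, f)_M`, and with `I(f) = 1`. -/
structure FunSpace.IsIntegral (S : FunSpace G V) (f : S.E) (hf : 0 ≤ (f : V))
    (I : S.dom f →ₗ[ℝ] ℝ) : Prop where
  nonneg : ∀ v : S.dom f, 0 ≤ ((v : S.E) : V) → 0 ≤ I v
  invariant : ∀ μ : Measure G, IsM001 μ → ∀ v w : S.dom f,
    ((w : S.E) : V) = S.act μ (v : S.E) → I w = I v
  normalized : I ⟨f, S.mem_dom_self f hf⟩ = 1

/-- The measurably invariant normalized integral property for `E`. -/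
def FunSpace.HasIntegralProperty (S : FunSpace G V) : Prop :=
  ∀ (f : S.E) (hf : 0 ≤ (f : V)), f ≠ 0 → ∃ I : S.dom f →ₗ[ℝ] ℝ, S.IsIntegral f hf I

end generic

section cru

/-- Right uniform continuity, i.e. norm continuity of the left translates of `F`. -/
def RightUnifCont (F : G → ℝ) : Prop :=
  ∀ ε > 0, ∃ U ∈ 𝓝 (1 : G), ∀ u ∈ U, ∀ x, |F (u * x) - F x| < ε

theorem RightUnifCont.continuous [IsTopologicalGroup G] {F : G → ℝ} (hF : RightUnifCont F) :
    Continuous F := by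
  rw [continuous_iff_continuousAt]
  intro x
  rw [ContinuousAt, Metric.tendsto_nhds]
  intro ε hε
  obtain ⟨U, hU, h⟩ := hF ε hε
  have ht : Filter.Tendsto (fun y : G => y * x⁻¹) (𝓝 x) (𝓝 1) := by
    have : Continuous (fun y : G => y * x⁻¹) := by fun_prop
    simpa using this.tendsto x
  filter_upwards [ht hU] with y hy
  have := h _ hy x
  simpa [Real.dist_eq] using this

/-- The space of bounded right uniformly continuous functions on `G`. -/
def Cru (G : Type*) [Group G] [TopologicalSpace G] : Submodule ℝ (G → ℝ) where
  carrier := {F | (∃ C, ∀ x, |F x| ≤ C) ∧ RightUnifCont F}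
  add_mem' := by
    rintro a b ⟨⟨A, hA⟩, ha⟩ ⟨⟨B, hB⟩, hb⟩
    refine ⟨⟨A + B, fun x => (abs_add_le _ _).trans (add_le_add (hA x) (hB x))⟩, ?_⟩
    intro ε hε
    obtain ⟨U, hU, h⟩ := ha (ε / 2) (half_pos hε)
    obtain ⟨W, hW, k⟩ := hb (ε / 2) (half_pos hε)
    refine ⟨U ∩ W, Filter.inter_mem hU hW, fun u hu x => ?_⟩
    have e : (a + b) (u * x) - (a + b) x = (a (u * x) - a x) + (b (u * x) - b x) := by
      simp only [Pi.add_apply]; ring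
    rw [e]
    exact (abs_add_le _ _).trans_lt (by linarith [h u hu.1 x, k u hu.2 x])
  zero_mem' := ⟨⟨0, by simp⟩, fun ε hε => ⟨Set.univ, Filter.univ_mem, by simpa using hε⟩⟩
  smul_mem' := by
    rintro c a ⟨⟨A, hA⟩, ha⟩
    refine ⟨⟨|c| * A, fun x => ?_⟩, ?_⟩
    · simp only [Pi.smul_apply, smul_eq_mul, abs_mul]
      exact mul_le_mul_of_nonneg_left (hA x) (abs_nonneg c)
    intro ε hε
    have hc : 0 < |c| + 1 := by positivity
    obtain ⟨U, hU, h⟩ := ha (ε / (|c| + 1)) (div_pos hε hc)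
    refine ⟨U, hU, fun u hu x => ?_⟩
    simp only [Pi.smul_apply, smul_eq_mul, ← mul_sub, abs_mul]
    have h1 := h u hu x
    rw [lt_div_iff₀ hc] at h1
    nlinarith [abs_nonneg (a (u * x) - a x), abs_nonneg c]

variable [IsTopologicalGroup G] [BorelSpace G]

theorem integrable_translate {F : G → ℝ} (hF : Measurable F) (hb : ∃ C, ∀ x, |F x| ≤ C)
    (μ : Measure G) [IsFiniteMeasure μ] (g : G) : Integrable (fun x => F (x⁻¹ * g)) μ := by
  obtain ⟨C, hC⟩ := hb
  have hm : Measurable (fun x : G => x⁻¹ * g) :=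
    Continuous.measurable (by fun_prop)
  exact Integrable.of_bound (hF.comp hm).aestronglyMeasurable C
    (Filter.Eventually.of_forall fun x => hC _)

theorem conv_add {F : G → ℝ} (hF : Measurable F) (hb : ∃ C, ∀ x, |F x| ≤ C)
    {μ ν : Measure G} (hμ : IsM00 μ) (hν : IsM00 ν) :
    conv (μ + ν) F = conv μ F + conv ν F := by
  have := hμ.finite
  have := hν.finite
  funext g
  exact integral_add_measure (integrable_translate hF hb μ g) (integrable_translate hF hb ν g)

theorem conv_smul (F : G → ℝ) (c : NNReal) (μ : Measure G) :
    conv (c • μ) F = (c : ℝ) • conv μ F := by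
  funext g
  simp only [conv, Pi.smul_apply]
  rw [integral_smul_nnreal_measure]
  rfl

theorem conv_one {F : G → ℝ} (hF : Measurable F) : conv (Measure.dirac 1) F = F := by
  funext g
  have hm : Measurable (fun x : G => F (x⁻¹ * g)) :=
    hF.comp (Continuous.measurable (by fun_prop))
  simp only [conv]
  rw [integral_dirac' _ _ hm.stronglyMeasurable]
  simp

/-- The space `C^b_ru(G)` with the convolution action. -/
noncomputable def cru (G : Type*) [Group G] [TopologicalSpace G] [MeasurableSpace G]
    [IsTopologicalGroup G] [BorelSpace G] : FunSpace G (G → ℝ) where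
  E := Cru G
  act μ f := conv μ f
  act_add _ _ hμ hν f := conv_add f.2.2.continuous.measurable f.2.1 hμ hν
  act_smul c μ _ _ := conv_smul _ c μ
  act_one f := conv_one f.2.2.continuous.measurable

end cru

section linf

open Filter

/-- The filter of complements of locally `m`-null sets: a property holds along it if and only if,
for each compact `K`, it holds at `m`-almost every point of `K`. -/
noncomputable def locAE (m : Measure G) : Filter G := ⨆ K ∈ {K : Set G | IsCompact K}, ae (m.restrict K)

theorem eventually_locAE {m : Measure G} [T2Space G] [BorelSpace G] {p : G → Prop} :
    (∀ᶠ x in locAE m, p x) ↔ ∀ K : Set G, IsCompact K → m ({x | ¬ p x} ∩ K) = 0 := by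
  simp only [locAE, Filter.eventually_iSup, Set.mem_ofPred_eq]
  refine forall₂_congr fun K hK => ?_
  rw [ae_iff, Measure.restrict_apply' hK.measurableSet]

instance posSMulMono_germ (m : Measure G) : PosSMulMono ℝ (Germ (locAE m) ℝ) where
  smul_le_smul_of_nonneg_left := by
    intro c hc a b
    induction a using Germ.inductionOn
    induction b using Germ.inductionOn
    intro hab
    rw [← Germ.coe_smul, ← Germ.coe_smul, Germ.coe_le]
    filter_upwards [Germ.coe_le.1 hab] with x hx
    exact mul_le_mul_of_nonneg_left hx hc

/-- `L^∞(G)`: the bounded Borel functions on `G`, modulo equality locally almost everywhere. -/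
def LInf (m : Measure G) : Submodule ℝ (Germ (locAE m) ℝ) where
  carrier := {h | ∃ F : G → ℝ, Measurable F ∧ (∃ C, ∀ x, |F x| ≤ C) ∧ (F : Germ (locAE m) ℝ) = h}
  add_mem' := by
    rintro _ _ ⟨F, hF, ⟨A, hA⟩, rfl⟩ ⟨H, hH, ⟨B, hB⟩, rfl⟩
    exact ⟨F + H, hF.add hH,
      ⟨A + B, fun x => (abs_add_le _ _).trans (add_le_add (hA x) (hB x))⟩, rfl⟩
  zero_mem' := ⟨0, measurable_const, ⟨0, by simp⟩, rfl⟩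
  smul_mem' := by
    rintro c _ ⟨F, hF, ⟨A, hA⟩, rfl⟩
    refine ⟨c • F, hF.const_smul c, ⟨|c| * A, fun x => ?_⟩, rfl⟩
    simp only [Pi.smul_apply, smul_eq_mul, abs_mul]
    exact mul_le_mul_of_nonneg_left (hA x) (abs_nonneg c)

/-- A bounded Borel function that represents the class `h`. -/
noncomputable def rep {m : Measure G} (h : LInf m) : G → ℝ := h.2.choose

theorem rep_measurable {m : Measure G} (h : LInf m) : Measurable (rep h) := h.2.choose_spec.1

theorem rep_bounded {m : Measure G} (h : LInf m) : ∃ C, ∀ x, |rep h x| ≤ C :=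
  h.2.choose_spec.2.1

theorem coe_rep {m : Measure G} (h : LInf m) : (rep h : Germ (locAE m) ℝ) = h :=
  h.2.choose_spec.2.2

/-- The space `L^∞(G)` with the convolution action: `μ * h` is the class of `μ * F`, where `F` is a
bounded Borel function in the class `h`. -/
noncomputable def linf [IsTopologicalGroup G] [BorelSpace G] (m : Measure G) :
    FunSpace G (Germ (locAE m) ℝ) where
  E := LInf m
  act μ h := (conv μ (rep h) : Germ (locAE m) ℝ)
  act_add _ _ hμ hν h := by
    rw [conv_add (rep_measurable h) (rep_bounded h) hμ hν]
    rfl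
  act_smul c μ _ h := by
    rw [conv_smul]
    rfl
  act_one h := by
    rw [conv_one (rep_measurable h), coe_rep]

/-- The function `(φ * h)(g) = ∫ φ(x) h(x⁻¹ g) dm(x)`, for a function `φ` and `h ∈ L^∞(G)`. -/
noncomputable def fconv (m : Measure G) (φ : G → ℝ) (h : LInf m) : G → ℝ :=
  fun g => ∫ x, φ x * rep h (x⁻¹ * g) ∂m

end linf

end MeasInv

namespace MeasInv

/-! ### Images of product measures under continuous maps, without second countability -/

section product

open Filter ProbabilityTheory
open scoped ENNReal

variable {X Y Z : Type*} [TopologicalSpace X] [TopologicalSpace Y] [TopologicalSpace Z]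
  [MeasurableSpace X] [MeasurableSpace Y] [MeasurableSpace Z] [BorelSpace X] [BorelSpace Y]
  [BorelSpace Z] {p : X → Y → Z}

/-! Smoothing by `φ` turns classes in `L^∞(G)` into functions in `C^b_ru(G)`; the two points are
that `T` respects the domination by `f`, and that `I ∘ T` inherits invariance although convolution
need not commute.

Domination: if `|h| ≤ μ * f`, then `|φ * h| ≤ φ * (μ * f) = ψ * f`, where `ψ ∈ C_c(G)` is the
density of the measure `(φ m) * μ` (`exists_dens_mconvBorel`). Finitely many left translates of `φ`,
suitably scaled, add up to a function above `ψ`, so `ψ * f ≤ ν * (φ * f)` for a finite combination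
`ν` of point masses (`exists_cconv_le`). The same covering by translates shows that `φ * f` is not
zero.

Invariance: fix `v ≥ 0` in the domain. Then `ψ ↦ I(ψ * v)` is a positive functional on `C_c(G)`, and
it is left invariant because `I` is invariant under point masses. By the Riesz theorem and
uniqueness of Haar measure, `I(ψ * v) = c ∫ ψ dm` (`integral_smooth_eq_of_nonneg`); differences give
this for all `v`. Now `φ * (μ * v) = ψ * v` with `ψ` the density of `(φ m) * μ`, and `∫ ψ dm = ∫ φ
dm` when `μ(G) = 1`, so `I(φ * (μ * v)) = I(φ * v)`.

The measure theory has to work for Borel functions on a group that is not second countable, where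
multiplication need not be measurable for the product σ-algebra. Regularity replaces this: preimages
of open sets are exhausted by countably many compact, product-measurable sets, which yields a
Tonelli theorem (`lintegral_measure_section_swap`) and regular convolutions (`regular_prodMap`). -/

theorem exists_nhds_prod_subset_preimage (hp : Continuous fun q : X × Y => p q.1 q.2)
    {U : Set Z} (hU : IsOpen U) (μ : Measure X) [μ.Regular] {t : ℝ≥0∞} {y : Y}
    (hy : t < μ {x | p x y ∈ U}) :
    ∃ C : Set X, IsCompact C ∧ t < μ C ∧ ∃ B ∈ 𝓝 y, ∀ x ∈ C, ∀ z ∈ B, p x z ∈ U := by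
  have ho : IsOpen {x | p x y ∈ U} :=
    hU.preimage (hp.comp (by fun_prop : Continuous fun x : X => (x, y)))
  obtain ⟨C, hCU, hC, htC⟩ := ho.exists_lt_isCompact hy
  obtain ⟨A, B, -, hB, hAC, hyB, hAB⟩ := generalized_tube_lemma hC (isCompact_singleton (x := y))
    (hU.preimage hp) (by rintro ⟨a, b⟩ ⟨ha, rfl⟩; exact hCU ha)
  exact ⟨C, hC, htC, B, hB.mem_nhds (hyB rfl), fun x hx z hz =>
    show (x, z) ∈ (fun q : X × Y => p q.1 q.2) ⁻¹' U from hAB ⟨hAC hx, hz⟩⟩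

/-- Lower semicontinuity: inner regularity puts a compact set of measure above `t` inside the
section, and by the tube lemma it stays inside all nearby sections. -/
theorem isOpen_lt_measure_section (hp : Continuous fun q : X × Y => p q.1 q.2)
    {U : Set Z} (hU : IsOpen U) (μ : Measure X) [μ.Regular] (t : ℝ≥0∞) :
    IsOpen {y | t < μ {x | p x y ∈ U}} := by
  refine isOpen_iff_mem_nhds.2 fun y hy => ?_
  obtain ⟨C, -, htC, B, hB, h⟩ := exists_nhds_prod_subset_preimage hp hU μ hy
  filter_upwards [hB] with z hz
  exact htC.trans_le (measure_mono fun x hx => h x hx z hz)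

/-- The images of a finite regular measure under the sections of a continuous map depend
measurably on the parameter. -/
theorem measurable_map_section (hp : Continuous fun q : X × Y => p q.1 q.2)
    (μ : Measure X) [IsFiniteMeasure μ] [μ.Regular] :
    Measurable fun y => μ.map fun x => p x y := by
  have hc : ∀ y, Continuous fun x => p x y := fun y =>
    hp.comp (by fun_prop : Continuous fun x : X => (x, y))
  refine Measurable.measure_of_isPiSystem (S := {U : Set Z | IsOpen U})
    (BorelSpace.measurable_eq) (fun U hU V hV _ => IsOpen.inter hU hV) ?_ ?_
  · intro U hU
    refine measurable_of_Ioi fun t => ?_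
    have e : (fun y => (μ.map fun x => p x y) U) ⁻¹' Set.Ioi t = {y | t < μ {x | p x y ∈ U}} := by
      ext y
      simp [Measure.map_apply (hc y).measurable (IsOpen.measurableSet hU), Set.preimage]
    rw [e]
    exact (isOpen_lt_measure_section hp hU μ t).measurableSet
  · simp only [Measure.map_apply (hc _).measurable MeasurableSet.univ]
    simp

theorem measurable_measure_section (hp : Continuous fun q : X × Y => p q.1 q.2)
    (μ : Measure X) [IsFiniteMeasure μ] [μ.Regular] {A : Set Z} (hA : MeasurableSet A) :
    Measurable fun y => μ {x | p x y ∈ A} := by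
  convert (Measure.measurable_coe hA).comp (measurable_map_section hp μ) using 2 with y
  rw [Function.comp_apply, Measure.map_apply _ hA]
  · rfl
  · exact (hp.comp (by fun_prop : Continuous fun x : X => (x, y))).measurable

/-- The image under a continuous map `p : X × Y → Z` of the product of a finite regular measure
on `X` with a measure on `Y`. (For the Borel structures, `p` need not be measurable on the product
measurable space.) -/
noncomputable def prodMap (p : X → Y → Z) (μ : Measure X) (ν : Measure Y) : Measure Z :=
  ν.bind fun y => μ.map fun x => p x y

theorem prodMap_apply (hp : Continuous fun q : X × Y => p q.1 q.2)
    (μ : Measure X) [IsFiniteMeasure μ] [μ.Regular] (ν : Measure Y) {A : Set Z}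
    (hA : MeasurableSet A) : prodMap p μ ν A = ∫⁻ y, μ {x | p x y ∈ A} ∂ν := by
  rw [prodMap, Measure.bind_apply hA (measurable_map_section hp μ).aemeasurable]
  refine lintegral_congr fun y => ?_
  rw [Measure.map_apply _ hA]
  · rfl
  · exact (hp.comp (by fun_prop : Continuous fun x : X => (x, y))).measurable

/-- At one level `t`: the open superlevel set is approximated from inside by a compact `K`, and `K`
is covered by finitely many `D` carrying compact rectangles `C ×ˢ D` with `t < μ C`. Their union is
`R`. -/
theorem exists_isCompact_section [T2Space X] [T2Space Y] [LocallyCompactSpace Y]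
    (hp : Continuous fun q : X × Y => p q.1 q.2) {U : Set Z} (hU : IsOpen U)
    (μ : Measure X) [μ.Regular] (ν : Measure Y) [IsFiniteMeasure ν] [ν.Regular]
    (t : ℝ≥0∞) {ε : ℝ≥0∞} (hε : ε ≠ 0) :
    ∃ R : Set (X × Y), IsCompact R ∧ MeasurableSet R ∧ (∀ q ∈ R, p q.1 q.2 ∈ U) ∧
      ν {y | t < μ {x | p x y ∈ U} ∧ ¬ t < μ {x | (x, y) ∈ R}} ≤ ε := by
  have hV := isOpen_lt_measure_section hp hU μ t
  obtain ⟨K, hKV, hK, hKε⟩ := hV.measurableSet.exists_isCompact_lt_add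
    (measure_ne_top ν _) hε
  have key : ∃ R : Set (X × Y), IsCompact R ∧ MeasurableSet R ∧ (∀ q ∈ R, p q.1 q.2 ∈ U) ∧
      ∀ y ∈ K, t < μ {x | (x, y) ∈ R} := by
    refine hK.induction_on (p := fun s => ∃ R : Set (X × Y), IsCompact R ∧ MeasurableSet R ∧
      (∀ q ∈ R, p q.1 q.2 ∈ U) ∧ ∀ y ∈ s, t < μ {x | (x, y) ∈ R}) ?_ ?_ ?_ ?_
    · exact ⟨∅, isCompact_empty, MeasurableSet.empty, by simp, by simp⟩
    · rintro s s' hs ⟨R, h1, h2, h3, h4⟩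
      exact ⟨R, h1, h2, h3, fun y hy => h4 y (hs hy)⟩
    · rintro s s' ⟨R, h1, h2, h3, h4⟩ ⟨R', h1', h2', h3', h4'⟩
      refine ⟨R ∪ R', h1.union h1', h2.union h2', fun q hq => hq.elim (h3 q) (h3' q), ?_⟩
      rintro y (hy | hy)
      · exact (h4 y hy).trans_le (measure_mono fun x hx => Or.inl hx)
      · exact (h4' y hy).trans_le (measure_mono fun x hx => Or.inr hx)
    · intro y hy
      obtain ⟨C, hC, htC, B, hB, h⟩ := exists_nhds_prod_subset_preimage hp hU μ (hKV hy)
      obtain ⟨D, hD, hDB, hDc⟩ := local_compact_nhds hB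
      refine ⟨D, mem_nhdsWithin_of_mem_nhds hD, C ×ˢ D, hC.prod hDc,
        hC.measurableSet.prod hDc.measurableSet, fun q hq => h _ hq.1 _ (hDB hq.2), ?_⟩
      intro z hz
      simpa [hz] using htC
  obtain ⟨R, h1, h2, h3, h4⟩ := key
  refine ⟨R, h1, h2, h3, ?_⟩
  calc _ ≤ ν ({y | t < μ {x | p x y ∈ U}} \ K) :=
        measure_mono fun y hy => ⟨hy.1, fun hyK => hy.2 (h4 y hyK)⟩
    _ ≤ ε := by
        rw [measure_sdiff hKV hK.measurableSet.nullMeasurableSet (measure_ne_top ν K)]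
        exact tsub_le_iff_left.2 hKε.le

/-- The preimage of an open set under a continuous map on a product of two finite regular measure
spaces is exhausted, up to a null set, by countably many compact sets that are measurable for the
product structure. -/
theorem exists_isCompact_seq [T2Space X] [T2Space Y] [LocallyCompactSpace Y]
    (hp : Continuous fun q : X × Y => p q.1 q.2) {U : Set Z} (hU : IsOpen U)
    (μ : Measure X) [μ.Regular] (ν : Measure Y) [IsFiniteMeasure ν] [ν.Regular] :
    ∃ R : ℕ → Set (X × Y), (∀ n, IsCompact (R n)) ∧ (∀ n, MeasurableSet (R n)) ∧
      (∀ n, ∀ q ∈ R n, p q.1 q.2 ∈ U) ∧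
      ∀ᵐ y ∂ν, μ {x | p x y ∈ U} ≤ μ {x | (x, y) ∈ ⋃ n, R n} := by
  -- Rational levels suffice to compare two measures, and the errors `1 / (n + 1)` make the
  -- exceptional set at each level null. Negative rationals only repeat the level zero.
  have h := fun i : ℚ × ℕ => exists_isCompact_section hp hU μ ν (Real.toNNReal i.1 : ℝ≥0∞)
    (ε := ((i.2 : ℝ≥0∞) + 1)⁻¹) (by simp)
  choose R h1 h2 h3 h4 using h
  obtain ⟨e⟩ : Nonempty (ℕ ≃ ℚ × ℕ) := ⟨(Denumerable.eqv (ℚ × ℕ)).symm⟩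
  refine ⟨fun n => R (e n), fun n => h1 _, fun n => h2 _, fun n => h3 _, ?_⟩
  have hU' : ⋃ n, R (e n) = ⋃ i, R i := e.surjective.iUnion_comp R
  rw [hU']
  have hq : ∀ q : ℚ, ∀ᵐ y ∂ν, ((Real.toNNReal q : ℝ≥0∞) < μ {x | p x y ∈ U} →
      (Real.toNNReal q : ℝ≥0∞) < μ {x | (x, y) ∈ ⋃ i, R i}) := by
    intro q
    rw [ae_iff]
    refine le_antisymm (ge_of_tendsto' (x := atTop)
      (f := fun n : ℕ => ((n : ℝ≥0∞) + 1)⁻¹) ?_ fun n => ?_) zero_le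
    · have := (ENNReal.tendsto_inv_nat_nhds_zero).comp (tendsto_add_atTop_nat 1)
      simpa [Function.comp_def] using this
    · refine (measure_mono fun y hy => ?_).trans (h4 (q, n))
      rw [Set.mem_ofPred_eq, Classical.not_imp] at hy
      refine ⟨hy.1, fun hlt => hy.2 (hlt.trans_le (measure_mono fun x hx => ?_))⟩
      exact Set.mem_iUnion.2 ⟨_, hx⟩
  filter_upwards [ae_all_iff.2 hq] with y hy
  refine le_of_forall_lt fun r hr => ?_
  obtain ⟨q, -, hq1, hq2⟩ := ENNReal.lt_iff_exists_rat_btwn.1 hr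
  exact hq1.trans (hy q hq2)

/-- The preimage of `U` may fail to be product-measurable, but `⋃ n, R n` is, so the usual Tonelli
theorem applies to it. Since the `R n` lie in the preimage, this one inequality, used in both orders
of integration, is enough for `prodMap_swap`. -/
theorem prodMap_le_prod [T2Space X] [T2Space Y] [LocallyCompactSpace Y]
    (hp : Continuous fun q : X × Y => p q.1 q.2) {U : Set Z} (hU : IsOpen U)
    (μ : Measure X) [IsFiniteMeasure μ] [μ.Regular] (ν : Measure Y) [IsFiniteMeasure ν]
    [ν.Regular] :
    ∃ R : ℕ → Set (X × Y), (∀ n, IsCompact (R n)) ∧ (∀ n, MeasurableSet (R n)) ∧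
      (∀ n, ∀ q ∈ R n, p q.1 q.2 ∈ U) ∧ prodMap p μ ν U ≤ μ.prod ν (⋃ n, R n) := by
  obtain ⟨R, h1, h2, h3, h4⟩ := exists_isCompact_seq hp hU μ ν
  refine ⟨R, h1, h2, h3, ?_⟩
  rw [prodMap_apply hp μ ν hU.measurableSet, Measure.prod_apply_symm (MeasurableSet.iUnion h2)]
  exact lintegral_mono_ae h4

theorem isFiniteMeasure_prodMap (hp : Continuous fun q : X × Y => p q.1 q.2)
    (μ : Measure X) [IsFiniteMeasure μ] [μ.Regular] (ν : Measure Y) [IsFiniteMeasure ν] :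
    IsFiniteMeasure (prodMap p μ ν) := by
  refine ⟨?_⟩
  rw [prodMap_apply hp μ ν MeasurableSet.univ]
  simpa using ENNReal.mul_lt_top (measure_lt_top μ _) (measure_lt_top ν _)

theorem prodMap_swap [T2Space X] [T2Space Y] [LocallyCompactSpace X] [LocallyCompactSpace Y]
    (hp : Continuous fun q : X × Y => p q.1 q.2)
    (μ : Measure X) [IsFiniteMeasure μ] [μ.Regular] (ν : Measure Y) [IsFiniteMeasure ν]
    [ν.Regular] : prodMap (fun y x => p x y) ν μ = prodMap p μ ν := by
  have hp' : Continuous fun q : Y × X => p q.2 q.1 :=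
    hp.comp (by fun_prop : Continuous fun q : Y × X => (q.2, q.1))
  have := isFiniteMeasure_prodMap hp μ ν
  have := isFiniteMeasure_prodMap (p := fun y x => p x y) hp' ν μ
  refine ext_of_generate_finite {U : Set Z | IsOpen U} BorelSpace.measurable_eq
    (fun U hU V hV _ => IsOpen.inter hU hV) (fun U hU => le_antisymm ?_ ?_) ?_
  · obtain ⟨R, -, h2, h3, h4⟩ := prodMap_le_prod (p := fun y x => p x y) hp' hU ν μ
    refine h4.trans ?_
    rw [Measure.prod_apply (MeasurableSet.iUnion h2), prodMap_apply hp μ ν (IsOpen.measurableSet hU)]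
    refine lintegral_mono fun y => measure_mono fun x hx => ?_
    obtain ⟨n, hn⟩ := Set.mem_iUnion.1 hx
    exact h3 n _ hn
  · obtain ⟨R, -, h2, h3, h4⟩ := prodMap_le_prod hp hU μ ν
    refine h4.trans ?_
    rw [Measure.prod_apply (MeasurableSet.iUnion h2),
      prodMap_apply (p := fun y x => p x y) hp' ν μ (IsOpen.measurableSet hU)]
    refine lintegral_mono fun y => measure_mono fun x hx => ?_
    obtain ⟨n, hn⟩ := Set.mem_iUnion.1 hx
    exact h3 n _ hn
  · rw [prodMap_apply hp μ ν MeasurableSet.univ,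
      prodMap_apply (p := fun y x => p x y) hp' ν μ MeasurableSet.univ]
    simp [mul_comm]

/-- A Tonelli theorem for sections of Borel sets, without second countability. -/
theorem lintegral_measure_section_swap [T2Space X] [T2Space Y] [LocallyCompactSpace X]
    [LocallyCompactSpace Y] (hp : Continuous fun q : X × Y => p q.1 q.2)
    (μ : Measure X) [IsFiniteMeasure μ] [μ.Regular] (ν : Measure Y) [IsFiniteMeasure ν]
    [ν.Regular] {A : Set Z} (hA : MeasurableSet A) :
    ∫⁻ x, ν {y | p x y ∈ A} ∂μ = ∫⁻ y, μ {x | p x y ∈ A} ∂ν := by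
  have hp' : Continuous fun q : Y × X => p q.2 q.1 :=
    hp.comp (by fun_prop : Continuous fun q : Y × X => (q.2, q.1))
  rw [← prodMap_apply hp μ ν hA, ← prodMap_swap hp, prodMap_apply hp' ν μ hA]

theorem regular_prodMap [T2Space X] [T2Space Y] [T2Space Z] [LocallyCompactSpace Y]
    (hp : Continuous fun q : X × Y => p q.1 q.2)
    (μ : Measure X) [IsFiniteMeasure μ] [μ.Regular] (ν : Measure Y) [IsFiniteMeasure ν]
    [ν.Regular] : (prodMap p μ ν).Regular := by
  have := isFiniteMeasure_prodMap hp μ ν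
  have H : (prodMap p μ ν).InnerRegularWRT IsCompact IsOpen := by
    intro U hU r hr
    obtain ⟨R, h1, h2, h3, h4⟩ := prodMap_le_prod hp hU μ ν
    have hr' := hr.trans_le h4
    -- A finite union of the `R n` already has measure above `r`; its image in `Z` is the required
    -- compact subset of `U`.
    rw [measure_iUnion_eq_iSup_accumulate, lt_iSup_iff] at hr'
    obtain ⟨n, hn⟩ := hr'
    have hc : IsCompact (Set.accumulate R n) :=
      (Set.finite_Iic n).isCompact_biUnion fun i _ => h1 i
    have hm : MeasurableSet (Set.accumulate R n) :=
      MeasurableSet.biUnion (Set.to_countable _) fun i _ => h2 i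
    refine ⟨(fun q : X × Y => p q.1 q.2) '' Set.accumulate R n, ?_, hc.image hp,
      hn.trans_le ?_⟩
    · rintro _ ⟨q, hq, rfl⟩
      obtain ⟨i, -, hi⟩ := Set.mem_accumulate.1 hq
      exact h3 i q hi
    · rw [prodMap_apply hp μ ν (hc.image hp).measurableSet, Measure.prod_apply_symm hm]
      exact lintegral_mono fun y => measure_mono fun x hx => ⟨(x, y), hx, rfl⟩
  have := Measure.InnerRegularWRT.weaklyRegular_of_finite (prodMap p μ ν)
    fun U hU r hr => by
      obtain ⟨K, h1, h2, h3⟩ := H hU r hr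
      exact ⟨K, h1, h2.isClosed, h3⟩
  exact { innerRegular := H }

theorem measurable_integral_section (hp : Continuous fun q : X × Y => p q.1 q.2)
    (μ : Measure X) [IsFiniteMeasure μ] [μ.Regular] {F : Z → ℝ} (hF : Measurable F) :
    Measurable fun y => ∫ x, F (p x y) ∂μ := by
  let κ : Kernel Y Z := ⟨fun y => μ.map fun x => p x y, measurable_map_section hp μ⟩
  have h : (fun y => ∫ x, F (p x y) ∂μ) = fun y => ∫ z, F z ∂κ y := by
    funext y
    exact (integral_map (hp.comp (by fun_prop : Continuous fun x : X => (x, y))).aemeasurable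
      hF.aestronglyMeasurable).symm
  rw [h]
  exact (hF.stronglyMeasurable.integral_kernel (κ := κ)).measurable

theorem integral_prodMap (hp : Continuous fun q : X × Y => p q.1 q.2)
    (μ : Measure X) [IsFiniteMeasure μ] [μ.Regular] (ν : Measure Y) [IsFiniteMeasure ν]
    {F : Z → ℝ} (hF : Measurable F) (hb : ∃ C, ∀ z, |F z| ≤ C) :
    ∫ z, F z ∂prodMap p μ ν = ∫ y, ∫ x, F (p x y) ∂μ ∂ν := by
  have := isFiniteMeasure_prodMap hp μ ν
  obtain ⟨C, hC⟩ := hb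
  let κ : Kernel Y Z := ⟨fun y => μ.map fun x => p x y, measurable_map_section hp μ⟩
  have e : (κ ∘ₖ Kernel.const Unit ν) () = prodMap p μ ν := rfl
  have hi : Integrable F ((κ ∘ₖ Kernel.const Unit ν) ()) := by
    rw [e]
    exact Integrable.of_bound hF.aestronglyMeasurable C (Filter.Eventually.of_forall hC)
  rw [← e, Kernel.integral_comp hi]
  simp only [Kernel.const_apply]
  refine integral_congr_ae (Filter.Eventually.of_forall fun y => ?_)
  exact integral_map (hp.comp (by fun_prop : Continuous fun x : X => (x, y))).aemeasurable
      hF.aestronglyMeasurable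

end product

/-! ### Convolution of measures, and locally null sets -/

section group

open Filter
open scoped ENNReal Pointwise

variable {G : Type*} [Group G] [TopologicalSpace G] [MeasurableSpace G] [IsTopologicalGroup G]
  [BorelSpace G]

/-- Bounded Borel functions. -/
def BddBorel (F : G → ℝ) : Prop := Measurable F ∧ ∃ C, ∀ x, |F x| ≤ C

theorem BddBorel.exists_pos {F : G → ℝ} (hF : BddBorel F) : ∃ C, 0 < C ∧ ∀ x, |F x| ≤ C := by
  obtain ⟨-, C, hC⟩ := hF
  exact ⟨|C| + 1, by positivity, fun x => (hC x).trans ((le_abs_self C).trans (by linarith))⟩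

theorem BddBorel.abs {F : G → ℝ} (hF : BddBorel F) : BddBorel fun x => |F x| :=
  ⟨hF.1.abs, hF.2.imp fun C hC x => by simpa using hC x⟩

theorem BddBorel.sup_zero {F : G → ℝ} (hF : BddBorel F) : BddBorel fun x => max (F x) 0 := by
  obtain ⟨C, h0, hC⟩ := hF.exists_pos
  refine ⟨hF.1.max measurable_const, C, fun x => ?_⟩
  rw [abs_of_nonneg (le_max_right _ _)]
  exact max_le ((le_abs_self _).trans (hC x)) h0.le

theorem BddBorel.add {F H : G → ℝ} (hF : BddBorel F) (hH : BddBorel H) : BddBorel (F + H) := by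
  obtain ⟨A, hA⟩ := hF.2
  obtain ⟨B, hB⟩ := hH.2
  exact ⟨hF.1.add hH.1, A + B, fun x => (abs_add_le _ _).trans (add_le_add (hA x) (hB x))⟩

theorem BddBorel.const_smul {F : G → ℝ} (hF : BddBorel F) (c : ℝ) : BddBorel (c • F) := by
  obtain ⟨A, hA⟩ := hF.2
  refine ⟨hF.1.const_smul c, |c| * A, fun x => ?_⟩
  rw [Pi.smul_apply, smul_eq_mul, abs_mul]
  exact mul_le_mul_of_nonneg_left (hA x) (abs_nonneg c)

theorem continuous_inv_mul_prod : Continuous fun q : G × G => q.1⁻¹ * q.2 := by fun_prop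

theorem BddBorel.conv {F : G → ℝ} (hF : BddBorel F) {μ : Measure G} (hμ : IsM00 μ) :
    BddBorel (conv μ F) := by
  have := hμ.finite
  have := hμ.regular
  obtain ⟨C, -, hC⟩ := hF.exists_pos
  refine ⟨measurable_integral_section (p := fun x g : G => x⁻¹ * g) continuous_inv_mul_prod μ hF.1,
    C * μ.real Set.univ, fun g => ?_⟩
  rw [← Real.norm_eq_abs]
  exact norm_integral_le_of_norm_le_const (f := fun x => F (x⁻¹ * g))
    (Eventually.of_forall fun x => hC (x⁻¹ * g))

/-- The convolution of two finite regular measures. -/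
noncomputable def mconvBorel (μ ν : Measure G) : Measure G := prodMap (fun y x => x * y) ν μ

theorem continuous_mul_swap : Continuous fun q : G × G => q.2 * q.1 := by fun_prop

theorem IsM00.mconvBorel [T2Space G] [LocallyCompactSpace G] {μ ν : Measure G} (hμ : IsM00 μ)
    (hν : IsM00 ν) : IsM00 (mconvBorel μ ν) := by
  obtain ⟨h1, h2, K, hK, hK0⟩ := hμ
  obtain ⟨h1', h2', L, hL, hL0⟩ := hν
  refine ⟨isFiniteMeasure_prodMap continuous_mul_swap ν μ, regular_prodMap continuous_mul_swap ν μ,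
    K * L, hK.mul hL, ?_⟩
  rw [MeasInv.mconvBorel, prodMap_apply continuous_mul_swap ν μ
    (hK.mul hL).measurableSet.compl]
  have h0 : ∀ᵐ x ∂μ, ν {y | x * y ∈ (K * L)ᶜ} = 0 := by
    have hK1 : ∀ᵐ x ∂μ, x ∈ K := by rwa [ae_iff]
    filter_upwards [hK1] with x hx
    exact measure_mono_null (fun y (hy : x * y ∈ (K * L)ᶜ) hyL => hy (Set.mul_mem_mul hx hyL)) hL0
  exact (lintegral_congr_ae h0).trans lintegral_zero

/-- No interchange of integrals is needed: `mconvBorel μ ν` integrates over `ν` inside and `μ`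
outside, the order on the left. -/
theorem conv_conv {F : G → ℝ} (hF : BddBorel F) {μ ν : Measure G} (hμ : IsM00 μ) (hν : IsM00 ν) :
    conv μ (conv ν F) = conv (mconvBorel μ ν) F := by
  have := hμ.finite
  have := hν.finite
  have := hν.regular
  funext g
  have hm : Measurable fun z : G => F (z⁻¹ * g) :=
    hF.1.comp (Continuous.measurable (by fun_prop))
  simp only [conv, mconvBorel]
  rw [integral_prodMap (F := fun z : G => F (z⁻¹ * g)) continuous_mul_swap ν μ hm
    (hF.2.imp fun C hC z => hC _)]
  simp [mul_assoc]

theorem measure_univ_mconvBorel {μ ν : Measure G} (hν : IsM00 ν) :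
    mconvBorel μ ν Set.univ = ν Set.univ * μ Set.univ := by
  have := hν.finite
  have := hν.regular
  rw [mconvBorel, prodMap_apply continuous_mul_swap ν μ MeasurableSet.univ]
  simp

theorem abs_conv_le (F : G → ℝ) (μ : Measure G) (g : G) :
    |conv μ F g| ≤ conv μ (fun x => |F x|) g :=
  abs_integral_le_integral_abs

variable (m : Measure G) [m.IsHaarMeasure] [m.Regular] [T2Space G]

/-- Locally null sets. -/
def LocNull (N : Set G) : Prop := ∀ K : Set G, IsCompact K → m (N ∩ K) = 0

variable {m}

theorem LocNull.smul {N : Set G} (hN : LocNull m N) (g : G) : LocNull m (g • N) := by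
  intro K hK
  have e : g • N ∩ K = g • (N ∩ g⁻¹ • K) := by
    rw [Set.smul_set_inter, smul_inv_smul]
  rw [e, measure_smul]
  exact hN _ (hK.smul _)

variable [LocallyCompactSpace G]

/-- By Tonelli it suffices to integrate over `g ∈ L` first; for fixed `x` this measures `x • N ∩ L`,
which is null by left invariance. -/
theorem LocNull.ae_section {N : Set G} (hN : LocNull m N) (hm : MeasurableSet N) {L : Set G}
    (hL : IsCompact L) {μ : Measure G} [IsFiniteMeasure μ] [μ.Regular] :
    ∀ᵐ g ∂(m.restrict L), μ {x | x⁻¹ * g ∈ N} = 0 := by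
  have hmL : m L ≠ ∞ := hL.measure_ne_top
  have : IsFiniteMeasure (m.restrict L) := isFiniteMeasure_restrict.2 hmL
  have : (m.restrict L).Regular := Measure.Regular.restrict_of_measure_ne_top hmL
  have h := lintegral_measure_section_swap (p := fun x g : G => x⁻¹ * g) continuous_inv_mul_prod μ
    (m.restrict L) hm
  have h0 : ∫⁻ x, (m.restrict L) {g | x⁻¹ * g ∈ N} ∂μ = 0 := by
    rw [← lintegral_zero (μ := μ)]
    refine lintegral_congr fun x => ?_
    rw [Measure.restrict_apply' hL.measurableSet]
    convert hN.smul x L hL using 3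
    ext g
    simp [Set.mem_smul_set_iff_inv_smul_mem]
  rw [h0] at h
  refine (lintegral_eq_zero_iff ?_).1 h.symm
  exact measurable_measure_section (p := fun x g : G => x⁻¹ * g) continuous_inv_mul_prod μ hm

/-- `LocNull.ae_section` is applied with Haar measure on a compact set as `μ`. One good `y` near the
identity is enough: `y • (N⁻¹ ∩ K₀)` lies in the null set `{x | x⁻¹ * y ∈ N} ∩ L * K₀`. -/
theorem LocNull.inv {N : Set G} (hN : LocNull m N) (hm : MeasurableSet N) : LocNull m N⁻¹ := by
  intro K₀ hK₀
  obtain ⟨L, hL, hL1⟩ := exists_compact_mem_nhds (1 : G)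
  have hK : IsCompact (L * K₀) := hL.mul hK₀
  have hmK : m (L * K₀) ≠ ∞ := hK.measure_ne_top
  have : IsFiniteMeasure (m.restrict (L * K₀)) := isFiniteMeasure_restrict.2 hmK
  have : (m.restrict (L * K₀)).Regular := Measure.Regular.restrict_of_measure_ne_top hmK
  have h := hN.ae_section hm hL (μ := m.restrict (L * K₀))
  have hpos : m L ≠ 0 := (Measure.measure_pos_of_mem_nhds m hL1).ne'
  have h2 : ∀ᵐ g ∂(m.restrict L), g ∈ L := ae_restrict_mem hL.measurableSet
  have : (ae (m.restrict L)).NeBot := by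
    rw [ae_neBot]
    simpa using hpos
  obtain ⟨y, hy, hyL⟩ := (h.and h2).exists
  rw [Measure.restrict_apply' hK.measurableSet] at hy
  rw [← measure_smul m y]
  refine measure_mono_null ?_ hy
  rintro _ ⟨x, ⟨hx, hxK⟩, rfl⟩
  exact ⟨by simpa using hx, Set.mul_mem_mul hyL hxK⟩

/-- If `N` is a locally null Borel set then so is `{x | x⁻¹ * g ∈ N}`. -/
theorem LocNull.inv_mul {N : Set G} (hN : LocNull m N) (hm : MeasurableSet N) (g : G) :
    LocNull m {x | x⁻¹ * g ∈ N} := by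
  convert (hN.inv hm).smul g using 1
  ext x
  simp [Set.mem_smul_set_iff_inv_smul_mem]

theorem eventually_locAE_iff {q : G → Prop} : (∀ᶠ x in locAE m, q x) ↔ LocNull m {x | ¬ q x} :=
  eventually_locAE

/-- Convolution by `μ` passes to classes because almost every translate of the exceptional set,
inside a given compact set, is `μ`-null. -/
theorem conv_mono_locAE {F H : G → ℝ} (hF : BddBorel F) (hH : BddBorel H) {μ : Measure G}
    (hμ : IsM00 μ) (h : F ≤ᶠ[locAE m] H) : conv μ F ≤ᶠ[locAE m] conv μ H := by
  have := hμ.finite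
  have := hμ.regular
  rw [EventuallyLE, eventually_locAE_iff] at h ⊢
  have hN : MeasurableSet {x | ¬ F x ≤ H x} := (measurableSet_le hF.1 hH.1).compl
  intro L hL
  have := h.ae_section hN hL (μ := μ)
  rw [← Measure.restrict_apply' hL.measurableSet]
  change ∀ᵐ g ∂(m.restrict L), conv μ F g ≤ conv μ H g
  filter_upwards [this] with g hg
  refine integral_mono_ae (integrable_translate hF.1 hF.2 μ g) (integrable_translate hH.1 hH.2 μ g)
    ?_
  exact hg

end group

/-! ### Convolution with functions in `C_c(G)` and their density measures -/

section density

open Filter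
open scoped ENNReal Pointwise

variable {G : Type*} [Group G] [TopologicalSpace G] [MeasurableSpace G] [IsTopologicalGroup G]
  [BorelSpace G] [T2Space G]

/-- The convolution `(φ * F)(g) = ∫ φ(x) F(x⁻¹ g) dm(x)` of two functions. -/
noncomputable def cconv (m : Measure G) (φ F : G → ℝ) : G → ℝ := fun g => ∫ x, φ x * F (x⁻¹ * g) ∂m

/-- The measure with density `φ` with respect to `m`. -/
noncomputable def dens (m : Measure G) (φ : G → ℝ) : Measure G :=
  m.withDensity fun x => ENNReal.ofReal (φ x)

variable {m : Measure G} [m.IsHaarMeasure] [m.Regular] {φ ψ : G → ℝ}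

theorem integrable_cconv (hφ : Continuous φ) (hc : HasCompactSupport φ) {F : G → ℝ}
    (hF : BddBorel F) (g : G) : Integrable (fun x => φ x * F (x⁻¹ * g)) m := by
  obtain ⟨hm, C, hC⟩ := hF
  exact (hφ.integrable_of_hasCompactSupport hc).mul_bdd
    (hm.comp (Continuous.measurable (by fun_prop))).aestronglyMeasurable
    (Eventually.of_forall fun x => hC (x⁻¹ * g))

theorem abs_cconv_le (φ F : G → ℝ) (g : G) :
    |cconv m φ F g| ≤ cconv m (fun x => |φ x|) (fun x => |F x|) g := by
  refine abs_integral_le_integral_abs.trans_eq ?_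
  simp only [abs_mul, cconv]

theorem cconv_mono_left (hφ : Continuous φ) (hc : HasCompactSupport φ) (hψ : Continuous ψ)
    (hc' : HasCompactSupport ψ) (h : ∀ x, φ x ≤ ψ x) {F : G → ℝ} (hF : BddBorel F)
    (h0 : ∀ x, 0 ≤ F x) (g : G) : cconv m φ F g ≤ cconv m ψ F g :=
  integral_mono (integrable_cconv hφ hc hF g) (integrable_cconv hψ hc' hF g)
    fun x => mul_le_mul_of_nonneg_right (h x) (h0 _)

theorem cconv_translate (φ F : G → ℝ) (u g : G) :
    cconv m φ F (u * g) = cconv m (fun x => φ (u * x)) F g := by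
  simp only [cconv]
  rw [← integral_mul_left_eq_self _ u]
  simp [mul_assoc]

theorem continuousOn_integral_abs_translate_sub (hφ : Continuous φ) (hc : HasCompactSupport φ)
    {t : Set G} (ht : IsCompact t) :
    ContinuousOn (fun u => ∫ x, |φ (u * x) - φ x| ∂m) t := by
  refine continuousOn_integral_of_compact_support (k := t⁻¹ * tsupport φ ∪ tsupport φ)
    ((ht.inv.mul hc).union hc) (Continuous.continuousOn ?_) ?_
  · simp only [Function.uncurry_def]
    fun_prop
  · intro u x hu hx
    rw [Set.mem_union, not_or] at hx
    have h1 : φ x = 0 := image_eq_zero_of_notMem_tsupport hx.2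
    have h2 : φ (u * x) = 0 := image_eq_zero_of_notMem_tsupport fun h =>
      hx.1 ⟨u⁻¹, Set.inv_mem_inv.2 hu, u * x, h, by simp⟩
    simp [h1, h2]

/-- A left translation of `φ * F` moves onto `φ`, so the oscillation is at most `C * ∫ |φ (u * x) -
φ x| dm`, which tends to `0` as `u → 1`. -/
theorem cconv_mem_Cru [LocallyCompactSpace G] (hφ : Continuous φ) (hc : HasCompactSupport φ)
    {F : G → ℝ} (hF : BddBorel F) : cconv m φ F ∈ Cru G := by
  obtain ⟨C, hC0, hC⟩ := hF.exists_pos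
  have hint : ∀ {ψ : G → ℝ}, Continuous ψ → HasCompactSupport ψ → ∀ g,
      |cconv m ψ F g| ≤ C * ∫ x, |ψ x| ∂m := by
    intro ψ hψ hc' g
    rw [← integral_const_mul]
    refine abs_integral_le_integral_abs.trans
      (integral_mono (integrable_cconv hψ hc' hF g).abs
        ((hψ.integrable_of_hasCompactSupport hc').abs.const_mul C) fun x => ?_)
    simp only [abs_mul]
    rw [mul_comm]
    exact mul_le_mul_of_nonneg_right (hC _) (abs_nonneg _)
  refine ⟨⟨_, hint hφ hc⟩, fun ε hε => ?_⟩
  obtain ⟨t, ht, ht1⟩ := exists_compact_mem_nhds (1 : G)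
  have hθ := (continuousOn_integral_abs_translate_sub (m := m) hφ hc ht).continuousAt ht1
  have h0 : ∫ x, |φ (1 * x) - φ x| ∂m = 0 := by simp
  rw [ContinuousAt, h0] at hθ
  have hev := hθ.eventually (gt_mem_nhds (div_pos hε hC0))
  refine ⟨_, hev, fun u hu x => ?_⟩
  have hu' : ∫ x, |φ (u * x) - φ x| ∂m < ε / C := hu
  have h1 : Continuous fun x => φ (u * x) := by fun_prop
  have h1c : HasCompactSupport fun x => φ (u * x) := hc.comp_homeomorph (Homeomorph.mulLeft u)
  have e : cconv m φ F (u * x) - cconv m φ F x = cconv m (fun y => φ (u * y) - φ y) F x := by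
    rw [cconv_translate]
    simp only [cconv, sub_mul]
    exact (integral_sub (integrable_cconv h1 h1c hF x) (integrable_cconv hφ hc hF x)).symm
  rw [e]
  refine (hint (h1.sub hφ) (h1c.sub hc) x).trans_lt ?_
  rw [mul_comm]
  exact (lt_div_iff₀ hC0).1 hu'

theorem bddBorel_of_mem_Cru {F : G → ℝ} (hF : F ∈ Cru G) : BddBorel F :=
  ⟨hF.2.continuous.measurable, hF.1⟩

/-- Locally null sets survive `x ↦ x⁻¹ * g`, and the compact support of `φ` makes them null. Hence
`φ * F` depends, at every point, only on the class of `F`. -/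
theorem ae_of_locAE [LocallyCompactSpace G] (hc : HasCompactSupport φ) {q : G → Prop}
    (hq : MeasurableSet {x | ¬ q x}) (h : ∀ᶠ x in locAE m, q x) (g : G) :
    ∀ᵐ x ∂m, φ x ≠ 0 → q (x⁻¹ * g) := by
  rw [eventually_locAE_iff] at h
  rw [ae_iff]
  refine measure_mono_null (fun x hx => ?_) (h.inv_mul hq g (tsupport φ) hc)
  rw [Set.mem_ofPred_eq, Classical.not_imp] at hx
  exact ⟨hx.2, subset_tsupport _ hx.1⟩

theorem cconv_mono_locAE [LocallyCompactSpace G] (hφ : Continuous φ) (hc : HasCompactSupport φ)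
    (h0 : ∀ x, 0 ≤ φ x) {F H : G → ℝ} (hF : BddBorel F) (hH : BddBorel H)
    (h : F ≤ᶠ[locAE m] H) (g : G) : cconv m φ F g ≤ cconv m φ H g := by
  refine integral_mono_ae (integrable_cconv hφ hc hF g) (integrable_cconv hφ hc hH g) ?_
  filter_upwards [ae_of_locAE hc (measurableSet_le hF.1 hH.1).compl h g] with x hx
  rcases eq_or_ne (φ x) 0 with h | h
  · simp [h]
  · exact mul_le_mul_of_nonneg_left (hx h) (h0 x)

theorem cconv_congr_locAE [LocallyCompactSpace G] (hc : HasCompactSupport φ)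
    {F H : G → ℝ} (hF : BddBorel F) (hH : BddBorel H)
    (h : F =ᶠ[locAE m] H) : cconv m φ F = cconv m φ H := by
  funext g
  refine integral_congr_ae ?_
  filter_upwards [ae_of_locAE hc (measurableSet_eq_fun hF.1 hH.1).compl h g] with x hx
  rcases eq_or_ne (φ x) 0 with h | h
  · simp [h]
  · simp [hx h]

theorem integral_dens (hφ : Continuous φ) (h0 : ∀ x, 0 ≤ φ x) (F : G → ℝ) :
    ∫ x, F x ∂dens m φ = ∫ x, φ x * F x ∂m := by
  rw [dens, integral_withDensity_eq_integral_toReal_smul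
    hφ.measurable.ennreal_ofReal (by simp)]
  simp [ENNReal.toReal_ofReal (h0 _)]

theorem conv_dens (hφ : Continuous φ) (h0 : ∀ x, 0 ≤ φ x) (F : G → ℝ) :
    conv (dens m φ) F = cconv m φ F := by
  funext g
  exact integral_dens hφ h0 _

theorem dens_univ (hφ : Continuous φ) (hc : HasCompactSupport φ) (h0 : ∀ x, 0 ≤ φ x) :
    dens m φ Set.univ = ENNReal.ofReal (∫ x, φ x ∂m) := by
  rw [dens, withDensity_apply _ MeasurableSet.univ, Measure.restrict_univ,
    ofReal_integral_eq_lintegral_ofReal (hφ.integrable_of_hasCompactSupport hc)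
      (Eventually.of_forall h0)]

theorem isM00_dens (hφ : Continuous φ) (hc : HasCompactSupport φ) : IsM00 (dens m φ) := by
  have hfin : IsFiniteMeasure (dens m φ) :=
    isFiniteMeasure_withDensity_ofReal (hφ.integrable_of_hasCompactSupport hc).2
  have hK : dens m φ (tsupport φ)ᶜ = 0 := by
    rw [dens, withDensity_apply _ hc.isCompact.measurableSet.compl]
    refine (setLIntegral_congr_fun (g := fun _ => 0) hc.isCompact.measurableSet.compl
      fun x hx => ?_).trans (by simp)
    simp [image_eq_zero_of_notMem_tsupport hx]
  have : (dens m φ).InnerRegular := by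
    refine ⟨fun A hA r hr => ?_⟩
    have hε : dens m φ A - r ≠ 0 := (tsub_pos_of_lt hr).ne'
    have hmK : MeasurableSet (A ∩ tsupport φ) := hA.inter hc.isCompact.measurableSet
    have hA' : dens m φ A ≤ dens m φ (A ∩ tsupport φ) := by
      calc dens m φ A ≤ dens m φ (A ∩ tsupport φ) + dens m φ (A \ tsupport φ) :=
            measure_le_inter_add_sdiff _ _ _
        _ = _ := by
            rw [measure_mono_null (s := A \ tsupport φ) (fun x hx => hx.2) hK, add_zero]
    -- Inner regularity passes from `m` to the density by absolute continuity of the integral: a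
    -- compact `L` that misses less than `δ` of `A ∩ tsupport φ` for `m` loses less than `dens m φ A
    -- - r`.
    obtain ⟨δ, hδ, h⟩ := exists_pos_setLIntegral_lt_of_measure_lt (μ := m)
      (f := fun x => ENNReal.ofReal (φ x))
      (by simpa [dens, withDensity_apply] using measure_ne_top (dens m φ) Set.univ) hε
    obtain ⟨L, hLA, hL, hLδ⟩ := hmK.exists_isCompact_sdiff_lt (μ := m)
      ((measure_mono Set.inter_subset_right).trans_lt hc.isCompact.measure_lt_top).ne hδ.ne'
    refine ⟨L, hLA.trans Set.inter_subset_left, hL, ?_⟩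
    have h1 := h _ hLδ
    rw [← withDensity_apply _ (hmK.diff hL.measurableSet)] at h1
    have h2 : dens m φ A ≤ dens m φ L + dens m φ ((A ∩ tsupport φ) \ L) :=
      hA'.trans ((measure_mono (by rw [Set.union_sdiff_self]; exact Set.subset_union_right)).trans
        (measure_union_le _ _))
    by_contra! hle
    have h3 : dens m φ A < r + (dens m φ A - r) :=
      h2.trans_lt (ENNReal.add_lt_add_of_le_of_lt (hle.trans_lt hr.lt_top).ne hle h1)
    rw [add_tsub_cancel_of_le hr.le] at h3
    exact lt_irrefl _ h3
  exact ⟨hfin, inferInstance, _, hc, hK⟩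

end density

/-! ### The modular function, densities of convolutions, and domination by translates -/

section smoothing

open Filter CompactlySupported
open scoped ENNReal Pointwise

variable {G : Type*} [Group G] [TopologicalSpace G] [MeasurableSpace G] [IsTopologicalGroup G]
  [BorelSpace G] [T2Space G] [LocallyCompactSpace G]

variable {m : Measure G} [m.IsHaarMeasure] [m.Regular] {φ ψ : G → ℝ}

/-- The modular function, as far as it acts on integrals of functions in `C_c(G)`. -/
theorem exists_modular (m : Measure G) [m.IsHaarMeasure] :
    ∃ c : G → ℝ, Continuous c ∧ (∀ y, 0 ≤ c y) ∧
      ∀ g : G → ℝ, Continuous g → HasCompactSupport g → ∀ y,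
        ∫ x, g (x * y) ∂m = c y * ∫ x, g x ∂m := by
  set c : G → ℝ := fun y => (Measure.haarScalarFactor (m.map (· * y)) m : ℝ) with hcdef
  have key : ∀ g : G → ℝ, Continuous g → HasCompactSupport g → ∀ y,
      ∫ x, g (x * y) ∂m = c y * ∫ x, g x ∂m := by
    intro g hg hg' y
    have h := Measure.integral_isMulLeftInvariant_eq_smul_of_hasCompactSupport
      (m.map (· * y)) m hg hg'
    rw [integral_map (by fun_prop) hg.aestronglyMeasurable, integral_smul_nnreal_measure] at h
    exact h
  refine ⟨c, ?_, fun y => NNReal.coe_nonneg _, key⟩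
  obtain ⟨g, hgc, hg0, hg1⟩ := exists_continuous_nonneg_pos (1 : G)
  -- Continuity of `c` is read off from the ratio of integrals for one fixed test function.
  have hpos : 0 < ∫ x, g x ∂m :=
    g.continuous.integral_pos_of_hasCompactSupport_nonneg_nonzero hgc hg0 hg1
  have e : c = fun y => (∫ x, g (x * y) ∂m) / ∫ x, g x ∂m := by
    funext y
    rw [key g g.continuous hgc y, mul_div_cancel_right₀ _ hpos.ne']
  rw [e]
  refine Continuous.div_const (continuous_iff_continuousAt.2 fun y => ?_) _
  obtain ⟨t, ht, hty⟩ := exists_compact_mem_nhds y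
  refine ContinuousOn.continuousAt (s := t) ?_ hty
  refine continuousOn_integral_of_compact_support (k := tsupport g * t⁻¹) (hgc.mul ht.inv)
    (Continuous.continuousOn ?_) ?_
  · simp only [Function.uncurry_def]
    fun_prop
  · intro y x hy hx
    refine image_eq_zero_of_notMem_tsupport fun h => hx ?_
    exact ⟨x * y, h, y⁻¹, Set.inv_mem_inv.2 hy, by simp⟩

/-- The convolution of a density in `C_c(G)` with a measure in `M₀₀(G)₊` has a density in
`C_c(G)`. -/
theorem exists_dens_mconvBorel (hφ : Continuous φ) (hc : HasCompactSupport φ) (h0 : ∀ x, 0 ≤ φ x)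
    {μ : Measure G} (hμ : IsM00 μ) :
    ∃ ψ : G → ℝ, Continuous ψ ∧ HasCompactSupport ψ ∧ (∀ x, 0 ≤ ψ x) ∧
      mconvBorel (dens m φ) μ = dens m ψ := by
  have hM := (isM00_dens (m := m) hφ hc).mconvBorel hμ
  have hD := isM00_dens (m := m) hφ hc
  obtain ⟨hfin, hreg, L, hL, hL0⟩ := hμ
  obtain ⟨c, hcc, hc0, hcm⟩ := exists_modular m
  obtain ⟨χ, hχ1, hχc, -, hχ0⟩ :=
    exists_continuousMap_one_of_isCompact_subset_isOpen hL isOpen_univ (Set.subset_univ L)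
  have hχc' : HasCompactSupport χ := hχc
  -- Substituting `x * y⁻¹` for `x` costs the modular factor `c y`. The cutoff `χ` equals one
  -- `μ`-almost everywhere and gives `k` compact support, so that integrals can be swapped for
  -- continuous integrands.
  set k : G → G → ℝ := fun x y => χ y * (φ (x * y⁻¹) * c y) with hk
  have hkc : Continuous (Function.uncurry k) := by
    simp only [hk, Function.uncurry_def]
    fun_prop
  have hk0 : ∀ x y, (x, y) ∉ (tsupport φ * tsupport χ) ×ˢ tsupport χ → k x y = 0 := by
    intro x y hxy
    by_contra h
    simp only [hk, mul_eq_zero, not_or] at h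
    have hy := subset_tsupport _ h.1
    refine hxy ⟨⟨x * y⁻¹, subset_tsupport _ h.2.1, y, hy, by simp⟩, hy⟩
  have hcomp : IsCompact ((tsupport φ * tsupport χ) ×ˢ tsupport χ) := (hc.mul hχc).prod hχc
  have hψc : Continuous fun x => ∫ y, k x y ∂μ := by
    rw [← continuousOn_univ]
    refine continuousOn_integral_of_compact_support hχc hkc.continuousOn ?_
    intro x y _ hy
    exact hk0 x y fun h => hy h.2
  have hψs : HasCompactSupport fun x => ∫ y, k x y ∂μ := by
    refine HasCompactSupport.intro (hc.mul hχc) fun x hx => ?_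
    simp only [hk0 x _ fun h => hx h.1, integral_zero]
  have hψ0 : ∀ x, 0 ≤ ∫ y, k x y ∂μ := fun x =>
    integral_nonneg fun y => mul_nonneg (hχ0 y).1 (mul_nonneg (h0 _) (hc0 y))
  refine ⟨_, hψc, hψs, hψ0, ?_⟩
  have := hM.regular
  have hDψ := isM00_dens (m := m) hψc hψs
  have := hDψ.regular
  have := hD.finite
  refine Measure.ext_of_integral_eq_on_compactlySupported fun f => ?_
  have hae : ∀ᵐ y ∂μ, χ y = 1 := by
    have : ∀ᵐ y ∂μ, y ∈ L := by rwa [ae_iff]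
    filter_upwards [this] with y hy
    exact hχ1 hy
  have hfb : ∃ C, ∀ z, |f z| ≤ C := f.hasCompactSupport.exists_bound_of_continuous f.continuous
  calc ∫ z, f z ∂mconvBorel (dens m φ) μ
      = ∫ x, φ x * ∫ y, f (x * y) ∂μ ∂m := by
        rw [mconvBorel, integral_prodMap (F := ⇑f) continuous_mul_swap _ _
          f.continuous.measurable hfb,
          integral_dens hφ h0]
    _ = ∫ x, ∫ y, φ x * (χ y * f (x * y)) ∂μ ∂m := by
        refine integral_congr_ae (Eventually.of_forall fun x => ?_)
        dsimp only
        rw [← integral_const_mul]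
        refine integral_congr_ae ?_
        filter_upwards [hae] with y hy
        rw [hy, one_mul]
    _ = ∫ y, ∫ x, φ x * (χ y * f (x * y)) ∂m ∂μ := by
        refine integral_integral_swap_of_hasCompactSupport ?_ ?_
        · simp only [Function.uncurry_def]
          fun_prop
        · refine HasCompactSupport.intro (hc.prod hχc') fun q hq => ?_
          by_contra h
          simp only [Function.uncurry, mul_eq_zero, not_or] at h
          exact hq ⟨subset_tsupport _ h.1, subset_tsupport _ h.2.1⟩
    _ = ∫ y, ∫ x, k x y * f x ∂m ∂μ := by
        refine integral_congr_ae (Eventually.of_forall fun y => ?_)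
        dsimp only
        have h := hcm (fun x => φ (x * y⁻¹) * f x) (by fun_prop) f.hasCompactSupport.mul_left y
        simp only [mul_inv_cancel_right] at h
        calc ∫ x, φ x * (χ y * f (x * y)) ∂m = χ y * ∫ x, φ x * f (x * y) ∂m := by
              rw [← integral_const_mul]
              congr 1 with x
              ring
          _ = ∫ x, k x y * f x ∂m := by
              rw [h, ← mul_assoc, ← integral_const_mul]
              congr 1 with x
              simp only [hk]
              ring
    _ = ∫ x, ∫ y, k x y * f x ∂μ ∂m := by
        refine (integral_integral_swap_of_hasCompactSupport ?_ ?_).symm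
        · exact hkc.mul (f.continuous.comp continuous_fst)
        · refine HasCompactSupport.intro hcomp fun q hq => ?_
          simp only [Function.uncurry, hk0 _ _ hq, zero_mul]
    _ = ∫ z, f z ∂dens m fun x => ∫ y, k x y ∂μ := by
        rw [integral_dens hψc hψ0]
        simp only [integral_mul_const]

theorem cconv_add_left (hφ : Continuous φ) (hc : HasCompactSupport φ) (hψ : Continuous ψ)
    (hc' : HasCompactSupport ψ) {F : G → ℝ} (hF : BddBorel F) :
    cconv m (φ + ψ) F = cconv m φ F + cconv m ψ F := by
  funext g
  simp only [cconv, Pi.add_apply, add_mul]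
  exact integral_add (integrable_cconv hφ hc hF g) (integrable_cconv hψ hc' hF g)

theorem cconv_smul_left (a : ℝ) (φ F : G → ℝ) : cconv m (a • φ) F = a • cconv m φ F := by
  funext g
  simp only [cconv, Pi.smul_apply, smul_eq_mul, mul_assoc]
  exact integral_const_mul _ _

theorem conv_dirac {F : G → ℝ} (hF : BddBorel F) (u g : G) :
    conv (Measure.dirac u) F g = F (u⁻¹ * g) := by
  have hm : Measurable fun x : G => F (x⁻¹ * g) :=
    hF.1.comp (Continuous.measurable (by fun_prop))
  exact integral_dirac' _ _ hm.stronglyMeasurable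

/-- By compactness finitely many scaled translates of `φ` sum to `θ ≥ 1` on `s`. Translating `φ` on
the left amounts to translating `φ * F`, so `θ * F` is a combination of translates of `φ * F`. -/
theorem exists_one_le_translates (hφ : Continuous φ) (hc : HasCompactSupport φ)
    (h0 : ∀ x, 0 ≤ φ x) {a : G} (ha : φ a ≠ 0) {s : Set G} (hs : IsCompact s) :
    ∃ ν : Measure G, IsM00 ν ∧ ∃ θ : G → ℝ, Continuous θ ∧ HasCompactSupport θ ∧ (∀ x, 0 ≤ θ x) ∧
      (∀ x ∈ s, 1 ≤ θ x) ∧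
      ∀ F : G → ℝ, BddBorel F → cconv m θ F = conv ν (cconv m φ F) := by
  refine hs.induction_on (p := fun s => ∃ ν : Measure G, IsM00 ν ∧ ∃ θ : G → ℝ, Continuous θ ∧
      HasCompactSupport θ ∧ (∀ x, 0 ≤ θ x) ∧ (∀ x ∈ s, 1 ≤ θ x) ∧
      ∀ F : G → ℝ, BddBorel F → cconv m θ F = conv ν (cconv m φ F)) ?_ ?_ ?_ ?_
  · refine ⟨(0 : NNReal) • Measure.dirac 1, (isM00_dirac 1).smul 0, 0, continuous_zero,
      HasCompactSupport.zero, by simp, by simp, fun F hF => ?_⟩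
    rw [conv_smul]
    funext g
    simp [cconv]
  · rintro s s' hs ⟨ν, hν, θ, h1, h2, h3, h4, h5⟩
    exact ⟨ν, hν, θ, h1, h2, h3, fun x hx => h4 x (hs hx), h5⟩
  · rintro s s' ⟨ν, hν, θ, h1, h2, h3, h4, h5⟩ ⟨ν', hν', θ', h1', h2', h3', h4', h5'⟩
    refine ⟨ν + ν', hν.add hν', θ + θ', h1.add h1', h2.add h2',
      fun x => add_nonneg (h3 x) (h3' x), ?_, fun F hF => ?_⟩
    · rintro x (hx | hx)
      · exact (h4 x hx).trans (le_add_of_nonneg_right (h3' x))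
      · exact (h4' x hx).trans (le_add_of_nonneg_left (h3 x))
    · have hb := bddBorel_of_mem_Cru (cconv_mem_Cru (m := m) hφ hc hF)
      rw [cconv_add_left h1 h2 h1' h2' hF, h5 F hF, h5' F hF, conv_add hb.1 hb.2 hν hν']
  · intro b hb
    have hpos : 0 < φ a := lt_of_le_of_ne (h0 a) ha.symm
    -- The translate by `u` takes the value `φ a` at `b`; the factor `2 / φ a` makes this `2`, which
    -- leaves room for values at least `1` near `b`.
    set u := b * a⁻¹ with hu
    set r : NNReal := (2 / φ a).toNNReal with hr
    have hr' : (r : ℝ) = 2 / φ a := Real.coe_toNNReal _ (by positivity)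
    have hcont : Continuous ((r : ℝ) • fun x => φ (u⁻¹ * x)) := by
      have : Continuous fun x => φ (u⁻¹ * x) := by fun_prop
      exact this.const_smul _
    refine ⟨{x | 1 ≤ ((r : ℝ) • fun x => φ (u⁻¹ * x)) x}, mem_nhdsWithin_of_mem_nhds ?_,
      r • Measure.dirac u, (isM00_dirac u).smul r, (r : ℝ) • fun x => φ (u⁻¹ * x), hcont, ?_, ?_,
      fun x hx => hx, fun F hF => ?_⟩
    · have h1 : 1 < ((r : ℝ) • fun x => φ (u⁻¹ * x)) b := by
        simp only [Pi.smul_apply, smul_eq_mul, hr', hu, mul_inv_rev, inv_inv, inv_mul_cancel_right]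
        rw [div_mul_cancel₀ _ hpos.ne']
        norm_num
      filter_upwards [hcont.continuousAt.eventually (lt_mem_nhds h1)] with x hx using hx.le
    · exact (hc.comp_homeomorph (Homeomorph.mulLeft u⁻¹)).smul_left (f := fun _ => (r : ℝ))
    · exact fun x => mul_nonneg r.2 (h0 _)
    · rw [cconv_smul_left, conv_smul]
      congr 1
      funext g
      rw [conv_dirac (bddBorel_of_mem_Cru (cconv_mem_Cru hφ hc hF)), cconv_translate]

/-- A convolution with a function in `C_c(G)` is dominated by translates of the convolution with any
other nonzero nonnegative function in `C_c(G)`. -/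
theorem exists_cconv_le (hφ : Continuous φ) (hc : HasCompactSupport φ)
    (h0 : ∀ x, 0 ≤ φ x) {a : G} (ha : φ a ≠ 0) (hψ : Continuous ψ) (hc' : HasCompactSupport ψ) :
    ∃ ν : Measure G, IsM00 ν ∧ ∀ F : G → ℝ, BddBorel F → (∀ x, 0 ≤ F x) → ∀ g,
      cconv m ψ F g ≤ conv ν (cconv m φ F) g := by
  obtain ⟨ν, hν, θ, h1, h2, h3, h4, h5⟩ := exists_one_le_translates (m := m) hφ hc h0 ha hc'
  obtain ⟨C, hC⟩ := hc'.exists_bound_of_continuous hψ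
  refine ⟨C.toNNReal • ν, hν.smul _, fun F hF hF0 g => ?_⟩
  rw [conv_smul, ← h5 F hF, ← cconv_smul_left]
  refine cconv_mono_left hψ hc' (h1.const_smul _)
    (h2.smul_left (f := fun _ => (C.toNNReal : ℝ))) (fun x => ?_) hF hF0 g
  simp only [Pi.smul_apply, smul_eq_mul]
  by_cases hx : x ∈ tsupport ψ
  · have h : ψ x ≤ C.toNNReal := (le_abs_self _).trans ((hC x).trans (Real.le_coe_toNNReal C))
    exact h.trans (le_mul_of_one_le_right C.toNNReal.2 (h4 x hx))
  · rw [image_eq_zero_of_notMem_tsupport hx]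
    exact mul_nonneg C.toNNReal.2 (h3 x)

/-- A bounded Borel function `F ≥ 0` whose convolution with a nonzero function `φ ≥ 0` in `C_c(G)`
vanishes is zero locally almost everywhere. -/
theorem eq_zero_of_cconv_eq_zero (hφ : Continuous φ) (hc : HasCompactSupport φ)
    (h0 : ∀ x, 0 ≤ φ x) {a : G} (ha : φ a ≠ 0) {F : G → ℝ} (hF : BddBorel F) (hF0 : ∀ x, 0 ≤ F x)
    (h : cconv m φ F = 0) : F =ᶠ[locAE m] 0 := by
  have hN : MeasurableSet {x | ¬ F x = 0} := (measurableSet_eq_fun hF.1 measurable_const).compl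
  have key : ∀ K : Set G, IsCompact K → m ({x | ¬ F x = 0}⁻¹ ∩ K) = 0 := by
    intro K hK
    obtain ⟨ν, hν, θ, h1, h2, h3, h4, h5⟩ := exists_one_le_translates (m := m) hφ hc h0 ha hK
    -- At the identity the convolution is `∫ θ x * F x⁻¹ dm`, so `F x⁻¹` vanishes almost everywhere
    -- on `K`.
    have hθ : cconv m θ F 1 = 0 := by
      rw [h5 F hF, h]
      simp [conv]
    have hz := (integral_eq_zero_iff_of_nonneg (fun x => mul_nonneg (h3 x) (hF0 _))
      (integrable_cconv h1 h2 hF 1)).1 hθ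
    refine measure_mono_null (fun x hx => ?_) (ae_iff.1 hz)
    refine mul_ne_zero (zero_lt_one.trans_le (h4 x hx.2)).ne' ?_
    simpa using hx.1
  have h' : LocNull m ({x | ¬ F x = 0}⁻¹)⁻¹ := LocNull.inv key hN.inv
  rw [inv_inv] at h'
  exact eventually_locAE_iff.2 h'

end smoothing

/-! ### The map `T` and the transfer of the integral -/

section transfer

open Filter CompactlySupported
open scoped ENNReal Pointwise

variable {G : Type*} [Group G] [TopologicalSpace G] [MeasurableSpace G] [IsTopologicalGroup G]
  [BorelSpace G] [T2Space G] [LocallyCompactSpace G]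

variable {m : Measure G} [m.IsHaarMeasure] [m.Regular] {φ ψ : G → ℝ}

theorem bddBorel_rep (h : LInf m) : BddBorel (rep h) := ⟨rep_measurable h, rep_bounded h⟩

/-- The class of a bounded Borel function in `L^∞(G)`. -/
noncomputable def BddBorel.toLInf {F : G → ℝ} (hF : BddBorel F) (m : Measure G) : LInf m :=
  ⟨(F : Germ (locAE m) ℝ), F, hF.1, hF.2, rfl⟩

theorem rep_eq_of_coe_eq {F : G → ℝ} {h : LInf m}
    (e : (h : Germ (locAE m) ℝ) = (F : Germ (locAE m) ℝ)) : rep h =ᶠ[locAE m] F :=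
  Germ.coe_eq.1 ((coe_rep h).trans e)

theorem rep_nonneg {h : LInf m} (h0 : 0 ≤ (h : Germ (locAE m) ℝ)) : 0 ≤ᶠ[locAE m] rep h := by
  rw [← coe_rep h] at h0
  exact Germ.coe_le.1 h0

theorem rep_add (h k : LInf m) : rep (h + k) =ᶠ[locAE m] rep h + rep k := by
  refine rep_eq_of_coe_eq ?_
  rw [Germ.coe_add, coe_rep, coe_rep]
  rfl

theorem rep_smul (c : ℝ) (h : LInf m) : rep (c • h) =ᶠ[locAE m] c • rep h := by
  refine rep_eq_of_coe_eq ?_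
  rw [Germ.coe_smul, coe_rep]
  rfl

theorem cconv_rep_add (hψ : Continuous ψ) (hc : HasCompactSupport ψ) (h k : LInf m) :
    cconv m ψ (rep (h + k)) = cconv m ψ (rep h) + cconv m ψ (rep k) := by
  have hh := bddBorel_rep h
  have hk := bddBorel_rep k
  rw [cconv_congr_locAE hc (bddBorel_rep _) (hh.add hk) (rep_add _ _)]
  funext g
  simp only [cconv, Pi.add_apply, mul_add]
  exact integral_add (integrable_cconv hψ hc hh g) (integrable_cconv hψ hc hk g)

theorem cconv_rep_smul (hc : HasCompactSupport ψ) (c : ℝ) (h : LInf m) :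
    cconv m ψ (rep (c • h)) = c • cconv m ψ (rep h) := by
  rw [cconv_congr_locAE hc (bddBorel_rep _) ((bddBorel_rep h).const_smul c) (rep_smul c _)]
  funext g
  simp only [cconv, Pi.smul_apply, smul_eq_mul, ← integral_const_mul]
  congr 1 with x
  ring

theorem cconv_rep_nonneg (hψ : Continuous ψ) (hc : HasCompactSupport ψ) (h0 : ∀ x, 0 ≤ ψ x)
    {h : LInf m} (hh : 0 ≤ (h : Germ (locAE m) ℝ)) : 0 ≤ cconv m ψ (rep h) := by
  intro g
  have e : cconv m ψ (fun _ => 0) g = 0 := by simp [cconv]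
  exact e.symm.trans_le (cconv_mono_locAE (F := fun _ => 0) hψ hc h0 ⟨measurable_const, 0, by simp⟩
    (bddBorel_rep h) (rep_nonneg hh) g)

theorem mem_dom_linf {f h : (linf m).E} : h ∈ (linf m).dom f ↔
    ∃ μ : Measure G, IsM00 μ ∧ (fun x => |rep h x|) ≤ᶠ[locAE m] conv μ (rep f) := by
  refine exists_congr fun μ => and_congr_right fun _ => ?_
  rw [← Germ.coe_le]
  have e : |(h : Germ (locAE m) ℝ)| = ((fun x => |rep h x|) : G → ℝ) := by
    conv_lhs => rw [← coe_rep h]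
    rfl
  rw [e]
  rfl

/-- This puts `ψ * h` in the domain of `φ * f`, for every `ψ ∈ C_c(G)` and not just `ψ = φ`; the
variable `ψ` is what the Haar uniqueness argument needs. -/
theorem abs_cconv_le_conv (hφ : Continuous φ) (hc : HasCompactSupport φ) (h0 : ∀ x, 0 ≤ φ x)
    {a : G} (ha : φ a ≠ 0) (hψ : Continuous ψ) (hc' : HasCompactSupport ψ) {F H : G → ℝ}
    (hF : BddBorel F) (hF0 : 0 ≤ᶠ[locAE m] F) (hH : BddBorel H) {μ : Measure G} (hμ : IsM00 μ)
    (h : (fun x => |H x|) ≤ᶠ[locAE m] conv μ F) :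
    ∃ ν : Measure G, IsM00 ν ∧ ∀ g, |cconv m ψ H g| ≤ conv ν (cconv m φ F) g := by
  obtain ⟨θ, hθ, hθc, hθ0, hθm⟩ := exists_dens_mconvBorel (m := m) hψ.abs hc'.norm
    (fun x => abs_nonneg (ψ x)) hμ
  obtain ⟨ν, hν, hle⟩ := exists_cconv_le (m := m) hφ hc h0 ha hθ hθc
  have hP : F =ᶠ[locAE m] fun x => max (F x) 0 := by
    filter_upwards [hF0] with x hx
    exact (max_eq_left hx).symm
  refine ⟨ν, hν, fun g => ?_⟩
  calc |cconv m ψ H g| ≤ cconv m (fun x => |ψ x|) (fun x => |H x|) g := abs_cconv_le ψ H g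
    _ ≤ cconv m (fun x => |ψ x|) (conv μ F) g :=
        cconv_mono_locAE hψ.abs hc'.norm (fun x => abs_nonneg _) hH.abs (hF.conv hμ) h g
    _ = cconv m θ F g := by
        rw [← conv_dens hψ.abs fun x => abs_nonneg _, conv_conv hF (isM00_dens hψ.abs hc'.norm) hμ,
          hθm, conv_dens hθ hθ0]
    _ = cconv m θ (fun x => max (F x) 0) g := by
        rw [cconv_congr_locAE hθc hF hF.sup_zero hP]
    _ ≤ conv ν (cconv m φ fun x => max (F x) 0) g :=
        hle _ hF.sup_zero (fun x => le_max_right _ _) g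
    _ = conv ν (cconv m φ F) g := by
        rw [cconv_congr_locAE hc hF hF.sup_zero hP]

theorem IsC001.exists_ne_zero (hφ : IsC001 m φ) : ∃ a, φ a ≠ 0 := by
  by_contra! h
  have := hφ.2.2.2
  simp [h] at this

/-- The element `φ * f` of `C^b_ru(G)`. -/
noncomputable def smoothed (hφ : IsC001 m φ) (f : (linf m).E) : (cru G).E :=
  ⟨cconv m φ (rep f), cconv_mem_Cru hφ.1 hφ.2.1 (bddBorel_rep f)⟩

/-- The map `h ↦ ψ * h` from `(L^∞(G), f)_M` to `(C^b_ru(G), φ * f)_M`, for `ψ ∈ C_c(G)`. -/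
noncomputable def smooth (hφ : IsC001 m φ) (f : (linf m).E)
    (hf : 0 ≤ (f : Germ (locAE m) ℝ)) (hψ : Continuous ψ) (hc : HasCompactSupport ψ) :
    (linf m).dom f →ₗ[ℝ] (cru G).dom (smoothed hφ f) where
  toFun h := ⟨⟨cconv m ψ (rep (h : (linf m).E)), cconv_mem_Cru hψ hc (bddBorel_rep _)⟩, by
    obtain ⟨μ, hμ, hle⟩ := mem_dom_linf.1 h.2
    obtain ⟨a, ha⟩ := hφ.exists_ne_zero
    exact abs_cconv_le_conv hφ.1 hφ.2.1 hφ.2.2.1 ha hψ hc (bddBorel_rep f) (rep_nonneg hf)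
      (bddBorel_rep _) hμ hle⟩
  map_add' _ _ := Subtype.ext (Subtype.ext (cconv_rep_add hψ hc _ _))
  map_smul' c _ := Subtype.ext (Subtype.ext (cconv_rep_smul hc c _))

theorem coe_smooth (hφ : IsC001 m φ) (f : (linf m).E)
    (hf : 0 ≤ (f : Germ (locAE m) ℝ)) (hψ : Continuous ψ) (hc : HasCompactSupport ψ)
    (h : (linf m).dom f) :
    ((smooth hφ f hf hψ hc h : (cru G).E) : G → ℝ) = cconv m ψ (rep (h : (linf m).E)) := rfl

theorem smoothed_nonneg (hφ : IsC001 m φ) {f : (linf m).E} (hf : 0 ≤ (f : Germ (locAE m) ℝ)) :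
    0 ≤ (smoothed hφ f : G → ℝ) :=
  cconv_rep_nonneg hφ.1 hφ.2.1 hφ.2.2.1 hf

theorem smooth_nonneg (hφ : IsC001 m φ) {f : (linf m).E} (hf : 0 ≤ (f : Germ (locAE m) ℝ))
    (hψ : Continuous ψ) (hc : HasCompactSupport ψ) (h0 : ∀ x, 0 ≤ ψ x) {h : (linf m).dom f}
    (hh : 0 ≤ ((h : (linf m).E) : Germ (locAE m) ℝ)) :
    0 ≤ ((smooth hφ f hf hψ hc h : (cru G).E) : G → ℝ) :=
  cconv_rep_nonneg hψ hc h0 hh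

theorem smoothed_ne_zero (hφ : IsC001 m φ) {f : (linf m).E} (hf : 0 ≤ (f : Germ (locAE m) ℝ))
    (hf0 : f ≠ 0) : smoothed hφ f ≠ 0 := by
  intro h
  have h' : cconv m φ (rep f) = 0 := congrArg Subtype.val h
  have hF := bddBorel_rep f
  have hP : rep f =ᶠ[locAE m] fun x => max (rep f x) 0 := by
    filter_upwards [rep_nonneg hf] with x hx
    exact (max_eq_left hx).symm
  rw [cconv_congr_locAE hφ.2.1 hF hF.sup_zero hP] at h'
  obtain ⟨a, ha⟩ := hφ.exists_ne_zero
  have hz := eq_zero_of_cconv_eq_zero hφ.1 hφ.2.1 hφ.2.2.1 ha hF.sup_zero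
    (fun x => le_max_right _ _) h'
  refine hf0 (Subtype.ext ?_)
  have e := (coe_rep f).symm.trans (Germ.coe_eq.2 (hP.trans hz))
  exact e

/-- The domain `(L^∞(G), f)_M` is stable under convolution by `M₀₀(G)₊`. -/
theorem conv_mem_dom (f : (linf m).E) {μ : Measure G} (hμ : IsM00 μ) (v : (linf m).dom f) :
    ((bddBorel_rep (v : (linf m).E)).conv hμ).toLInf m ∈ (linf m).dom f := by
  have hv := bddBorel_rep (v : (linf m).E)
  obtain ⟨ν, hν, hle⟩ := mem_dom_linf.1 v.2
  refine mem_dom_linf.2 ⟨mconvBorel μ ν, hμ.mconvBorel hν, ?_⟩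
  rw [← conv_conv (bddBorel_rep f) hμ hν]
  have h1 := conv_mono_locAE hv.abs ((bddBorel_rep f).conv hν) hμ hle
  have h2 : rep ((hv.conv hμ).toLInf m) =ᶠ[locAE m] conv μ (rep (v : (linf m).E)) :=
    rep_eq_of_coe_eq rfl
  filter_upwards [h1, h2] with x hx1 hx2
  rw [hx2]
  exact (abs_conv_le _ _ _).trans hx1

theorem isM001_dirac (g : G) : IsM001 (Measure.dirac g) := ⟨isM00_dirac g, by simp⟩

variable {f : (linf m).E} {hf : 0 ≤ (f : Germ (locAE m) ℝ)}

/-- Positivity of `v` makes `ψ ↦ I (ψ * v)` a positive functional, hence a Radon measure `n`; left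
invariance makes `n` a multiple of `m`. -/
theorem integral_smooth_eq_of_nonneg (hφ : IsC001 m φ)
    {I : (cru G).dom (smoothed hφ f) →ₗ[ℝ] ℝ}
    (hI : (cru G).IsIntegral (smoothed hφ f) (smoothed_nonneg hφ hf) I)
    {v : (linf m).dom f} (hv : 0 ≤ ((v : (linf m).E) : Germ (locAE m) ℝ)) :
    ∃ c : ℝ, ∀ (ψ : G → ℝ) (hψ : Continuous ψ) (hc : HasCompactSupport ψ),
      I (smooth hφ f hf hψ hc v) = c * ∫ x, ψ x ∂m := by
  have hr := bddBorel_rep (v : (linf m).E)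
  let L : C_c(G, ℝ) →ₗ[ℝ] ℝ :=
    { toFun := fun ψ => I (smooth hφ f hf ψ.continuous ψ.hasCompactSupport v)
      map_add' := fun ψ θ => by
        rw [← map_add]
        congr 1
        exact Subtype.ext (Subtype.ext (cconv_add_left ψ.continuous ψ.hasCompactSupport
          θ.continuous θ.hasCompactSupport hr))
      map_smul' := fun a ψ => by
        rw [RingHom.id_apply, ← map_smul]
        congr 1
        exact Subtype.ext (Subtype.ext (cconv_smul_left a ψ _)) }
  let Λ : C_c(G, ℝ) →ₚ[ℝ] ℝ := PositiveLinearMap.mk₀ L fun ψ h0 =>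
    hI.nonneg _ (smooth_nonneg hφ hf ψ.continuous ψ.hasCompactSupport h0 hv)
  let n : Measure G := RealRMK.rieszMeasure Λ
  have : n.Regular := RealRMK.regular_rieszMeasure Λ
  have hΛ : ∀ ψ : C_c(G, ℝ), ∫ x, ψ x ∂n =
      I (smooth hφ f hf ψ.continuous ψ.hasCompactSupport v) := fun ψ =>
    RealRMK.integral_rieszMeasure Λ ψ
  have hinv : n.IsMulLeftInvariant := by
    refine ⟨fun g => ?_⟩
    have : (n.map (g * ·)).Regular :=
      Measure.Regular.map (Homeomorph.mulLeft g)
    refine Measure.ext_of_integral_eq_on_compactlySupported fun ψ => ?_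
    rw [integral_map (f := ⇑ψ) (by fun_prop) ψ.continuous.aestronglyMeasurable, hΛ]
    let θ : C_c(G, ℝ) := ⟨⟨fun x => ψ (g * x), by fun_prop⟩,
      ψ.hasCompactSupport.comp_homeomorph (Homeomorph.mulLeft g)⟩
    -- Invariance of `I` is used only here, and only for point masses.
    refine (hΛ θ).trans (hI.invariant _ (isM001_dirac g⁻¹) _ _ ?_)
    funext x
    refine Eq.trans ?_ (conv_dirac (bddBorel_of_mem_Cru (cconv_mem_Cru (m := m) ψ.continuous
      ψ.hasCompactSupport hr)) g⁻¹ x).symm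
    rw [inv_inv, cconv_translate]
    rfl
  have heq := Measure.isMulLeftInvariant_eq_smul_of_regular n m
  refine ⟨Measure.haarScalarFactor n m, fun ψ hψ hc => ?_⟩
  refine (hΛ ⟨⟨ψ, hψ⟩, hc⟩).symm.trans ?_
  have h : ∫ x, ψ x ∂n = ∫ x, ψ x ∂(n.haarScalarFactor m • m) :=
    congrArg (fun k : Measure G => ∫ x, ψ x ∂k) heq
  exact h.trans (integral_smul_nnreal_measure _ _)

/-- By uniqueness of Haar measure, `I(ψ * v)` depends on `ψ ∈ C_c(G)` only through its integral. -/
theorem integral_smooth_eq (hφ : IsC001 m φ)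
    {I : (cru G).dom (smoothed hφ f) →ₗ[ℝ] ℝ}
    (hI : (cru G).IsIntegral (smoothed hφ f) (smoothed_nonneg hφ hf) I)
    (v : (linf m).dom f) :
    ∃ c : ℝ, ∀ (ψ : G → ℝ) (hψ : Continuous ψ) (hc : HasCompactSupport ψ),
      I (smooth hφ f hf hψ hc v) = c * ∫ x, ψ x ∂m := by
  obtain ⟨μ, hμ, hle⟩ := mem_dom_linf.1 v.2
  have hdom := conv_mem_dom f hμ ⟨f, (linf m).mem_dom_self f hf⟩
  -- The dominating class `w = μ * f` gives `v = w - (w - v)` with both terms nonnegative.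
  let w : (linf m).dom f := ⟨_, hdom⟩
  have hw : ((w : (linf m).E) : Germ (locAE m) ℝ) = (conv μ (rep f) : G → ℝ) := rfl
  have hv : ((v : (linf m).E) : Germ (locAE m) ℝ) = (rep (v : (linf m).E) : G → ℝ) :=
    (coe_rep _).symm
  have hw0 : 0 ≤ ((w : (linf m).E) : Germ (locAE m) ℝ) := by
    rw [hw]
    refine Germ.coe_le.2 ?_
    filter_upwards [hle] with x hx using (abs_nonneg _).trans hx
  have hwv0 : 0 ≤ (((w - v : (linf m).dom f) : (linf m).E) : Germ (locAE m) ℝ) := by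
    have h : ((v : (linf m).E) : Germ (locAE m) ℝ) ≤ ((w : (linf m).E) : Germ (locAE m) ℝ) := by
      rw [hw, hv]
      refine Germ.coe_le.2 ?_
      filter_upwards [hle] with x hx using (le_abs_self _).trans hx
    exact sub_nonneg.2 h
  obtain ⟨c, hc⟩ := integral_smooth_eq_of_nonneg (hf := hf) hφ hI hw0
  obtain ⟨d, hd⟩ := integral_smooth_eq_of_nonneg (hf := hf) hφ hI hwv0
  refine ⟨c - d, fun ψ hψ hψc => ?_⟩
  have h : I (smooth hφ f hf hψ hψc (w - v)) =
      I (smooth hφ f hf hψ hψc w) - I (smooth hφ f hf hψ hψc v) :=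
    (I ∘ₗ smooth hφ f hf hψ hψc).map_sub w v
  rw [sub_mul, ← hc ψ hψ hψc, ← hd ψ hψ hψc, h, sub_sub_cancel]

/-- Associativity moves `μ` from `v` onto `φ`, replacing `φ` by a `ψ` with the same integral, and `I
(ψ * v)` sees only that integral. -/
theorem isIntegral_comp_smooth (hφ : IsC001 m φ)
    {I : (cru G).dom (smoothed hφ f) →ₗ[ℝ] ℝ}
    (hI : (cru G).IsIntegral (smoothed hφ f) (smoothed_nonneg hφ hf) I) :
    (linf m).IsIntegral f hf (I ∘ₗ smooth hφ f hf hφ.1 hφ.2.1) where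
  nonneg v hv := hI.nonneg _ (smooth_nonneg hφ hf _ _ hφ.2.2.1 hv)
  normalized := hI.normalized
  invariant μ hμ v w hw := by
    have hv := bddBorel_rep (v : (linf m).E)
    have hwr : rep (w : (linf m).E) =ᶠ[locAE m] conv μ (rep (v : (linf m).E)) :=
      rep_eq_of_coe_eq hw
    obtain ⟨ψ, hψ, hψc, hψ0, hψm⟩ := exists_dens_mconvBorel (m := m) hφ.1 hφ.2.1 hφ.2.2.1 hμ.1
    -- Total masses multiply under convolution, and `μ` has mass one.
    have hint : ∫ x, ψ x ∂m = ∫ x, φ x ∂m := by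
      have h := measure_univ_mconvBorel (μ := dens m φ) hμ.1
      rw [hψm, hμ.2, one_mul, dens_univ hψ hψc hψ0, dens_univ hφ.1 hφ.2.1 hφ.2.2.1] at h
      exact (ENNReal.ofReal_eq_ofReal_iff (integral_nonneg hψ0) (integral_nonneg hφ.2.2.1)).1 h
    have e : smooth hφ f hf hφ.1 hφ.2.1 w = smooth hφ f hf hψ hψc v := by
      refine Subtype.ext (Subtype.ext ?_)
      rw [coe_smooth, coe_smooth, cconv_congr_locAE hφ.2.1 (bddBorel_rep _) (hv.conv hμ.1) hwr,
        ← conv_dens hφ.1 hφ.2.2.1, conv_conv hv (isM00_dens hφ.1 hφ.2.1) hμ.1, hψm,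
        conv_dens hψ hψ0]
    obtain ⟨c, hc⟩ := integral_smooth_eq hφ hI v
    rw [LinearMap.comp_apply, LinearMap.comp_apply, e, hc, hc, hint]

theorem exists_isC001 (m : Measure G) [m.IsHaarMeasure] : ∃ φ : G → ℝ, IsC001 m φ := by
  obtain ⟨g, hgc, hg0, hg1⟩ := exists_continuous_nonneg_pos (1 : G)
  have hpos : 0 < ∫ x, g x ∂m :=
    g.continuous.integral_pos_of_hasCompactSupport_nonneg_nonzero hgc hg0 hg1
  refine ⟨fun x => (∫ x, g x ∂m)⁻¹ * g x, by fun_prop, hgc.mul_left,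
    fun x => mul_nonneg (inv_nonneg.2 hpos.le) (hg0 x), ?_⟩
  rw [integral_const_mul, inv_mul_cancel₀ hpos.ne']

end transfer

end MeasInv

theorem mainTheorem6 {G : Type*} [Group G] [TopologicalSpace G] [IsTopologicalGroup G]
    [LocallyCompactSpace G] [T2Space G] [MeasurableSpace G] [BorelSpace G]
    (m : MeasureTheory.Measure G) [m.IsHaarMeasure] [m.Regular]
    (hG : (MeasInv.cru G).HasIntegralProperty) :
    (MeasInv.linf m).HasIntegralProperty ∧
    -- the domain `L^∞(G, f)_M` is stable under convolution, so invariance is never a void condition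
    (∀ f : (MeasInv.linf m).E, 0 ≤ (f : Filter.Germ (MeasInv.locAE m) ℝ) → f ≠ 0 →
      ∀ μ : MeasureTheory.Measure G, MeasInv.IsM001 μ → ∀ v : (MeasInv.linf m).dom f,
        ∃ w : (MeasInv.linf m).dom f,
          ((w : (MeasInv.linf m).E) : Filter.Germ (MeasInv.locAE m) ℝ) =
            (MeasInv.linf m).act μ (v : (MeasInv.linf m).E)) ∧
    -- the integrals are obtained by composition with `h ↦ φ * h`
    (∀ φ : G → ℝ, MeasInv.IsC001 m φ →
      ∀ (f : (MeasInv.linf m).E) (hf : 0 ≤ (f : Filter.Germ (MeasInv.locAE m) ℝ)), f ≠ 0 →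
        ∃ (F : (MeasInv.cru G).E) (hF : 0 ≤ (F : G → ℝ))
          (T : (MeasInv.linf m).dom f →ₗ[ℝ] (MeasInv.cru G).dom F),
          (F : G → ℝ) = MeasInv.fconv m φ f ∧ F ≠ 0 ∧
          (∀ h : (MeasInv.linf m).dom f,
            ((T h : (MeasInv.cru G).E) : G → ℝ) =
              MeasInv.fconv m φ (h : (MeasInv.linf m).E)) ∧
          ∀ I : (MeasInv.cru G).dom F →ₗ[ℝ] ℝ, (MeasInv.cru G).IsIntegral F hF I →
            (MeasInv.linf m).IsIntegral f hf (I ∘ₗ T)) := by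
  refine ⟨fun f hf hf0 => ?_, fun f _ _ μ hμ v => ⟨⟨_, MeasInv.conv_mem_dom f hμ.1 v⟩, rfl⟩,
    fun φ hφ f hf hf0 => ⟨MeasInv.smoothed hφ f, MeasInv.smoothed_nonneg hφ hf,
      MeasInv.smooth hφ f hf hφ.1 hφ.2.1, rfl, MeasInv.smoothed_ne_zero hφ hf hf0, fun _ => rfl,
      fun _ hI => MeasInv.isIntegral_comp_smooth hφ hI⟩⟩
  obtain ⟨φ, hφ⟩ := MeasInv.exists_isC001 m
  obtain ⟨I, hI⟩ := hG _ (MeasInv.smoothed_nonneg hφ hf) (MeasInv.smoothed_ne_zero hφ hf hf0)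
  exact ⟨_, MeasInv.isIntegral_comp_smooth hφ hI⟩
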